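/- For integers $k\ge 1$ and $n\ge 0$ let $p_{-k}(n)$ be the number of $k$-colored partitions of $n$, i.e. partitions of $n$ in which each part carries one of $k$ colors. For $j\ge 1$ let $E_j=(q^j;q^j)_\infty=\prod_{n\ge 1}(1-q^{jn})$, as a formal power series in $q$. Let $\{m(i,j)\}_{i,j\ge1}$ be Hirschhorn's matrix: its first column is $m(1,1)=5$, $m(2,1)=10$, $m(3,1)=9$, $m(4,1)=4$, $m(5,1)=1$, and $m(i,1)=0$ for $i\ge 6$; and for $j\ge 2$, $i\ge 1$, $$m(i,j)=25\,m(i-1,j-1)+25\,m(i-2,j-1)+15\,m(i-3,j-1)+5\,m(i-4,j-1)+m(i-5,j-1),$$ where entries with row index $\le 0$ are read as $0$. Let $\{a(j,k)\}_{j,k\ge1}$ be the matrix of natural numbers given by $a(1,1)=10$, $a(1,2)=125$, $a(1,k)=0$ for $k\ge3$, and $$a(j+1,k)=\begin{cases}\sum_{i=1}^{\infty}a(j,i)\,m(6i,i+k) & \text{if } j \text{ is odd},\\[2pt] \sum_{i=1}^{\infty}a(j,i)\,m(6i+2,i+k) & \text{if } j \text{ is even},\end{cases}$$ where the sums are finite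 because $m(i,j)=0$ for $i>5j$. **Theorem.** For every positive integer $j$, $$\sum_{n=0}^{\infty}p_{-2}\left(5^{2j-1}n+\frac{7\cdot5^{2j-1}+1}{12}\right)q^{n}=\sum_{l=1}^{\infty}a(2j-1,l)\,q^{l-1}\frac{E_{5}^{6l-2}}{E_{1}^{6l}},$$ $$\sum_{n=0}^{\infty}p_{-2}\left(5^{2j}n+\frac{11\cdot5^{2j}+1}{12}\right)q^{n}=\sum_{l=1}^{\infty}a(2j,l)\,q^{l-1}\frac{E_{5}^{6l}}{E_{1}^{6l+2}}.$$ -/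

import Mathlib

/-- `s` is a `k`-colored partition of `n`: a finite multiset of positive parts, each part carrying
one of `k` colors, whose parts sum to `n`. -/
def IsColoredPartition (k n : ℕ) (s : Multiset (ℕ × Fin k)) : Prop :=
  (∀ x ∈ s, 0 < x.1) ∧ (s.map Prod.fst).sum = n

/-- A number has only finitely many `k`-colored partitions. -/
theorem finite_coloredPartitions (k n : ℕ) :
    {s : Multiset (ℕ × Fin k) | IsColoredPartition k n s}.Finite := by
  refine (Set.finite_Iic (n • (Finset.Icc 1 n ×ˢ (Finset.univ : Finset (Fin k))).val)).subset ?_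
  rintro s ⟨hpos, hsum⟩
  have hle : ∀ x ∈ s, x.1 ≤ n := fun x hx =>
    hsum ▸ Multiset.le_sum_of_mem (Multiset.mem_map_of_mem Prod.fst hx)
  have hcard : s.card ≤ n := by
    have h := Multiset.card_nsmul_le_sum (s := s.map Prod.fst) (a := 1) (by
      intro y hy
      obtain ⟨x, hx, rfl⟩ := Multiset.mem_map.mp hy
      exact hpos x hx)
    simpa [hsum] using h
  refine Multiset.le_iff_count.mpr fun x => ?_
  by_cases hx : x ∈ s
  · have hm : x ∈ Finset.Icc 1 n ×ˢ (Finset.univ : Finset (Fin k)) := by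
      simp only [Finset.mem_product, Finset.mem_Icc, Finset.mem_univ, and_true]
      exact ⟨hpos x hx, hle x hx⟩
    rw [Multiset.count_nsmul, Multiset.count_eq_one_of_mem (Finset.nodup _) hm, mul_one]
    exact (Multiset.count_le_card x s).trans hcard
  · simp [Multiset.count_eq_zero_of_notMem hx]

/-- The number `p_{-k}(n)` of `k`-colored partitions of `n`. -/
noncomputable def coloredPartitionCount (k n : ℕ) : ℕ :=
  {s : Multiset (ℕ × Fin k) | IsColoredPartition k n s}.ncard

open scoped PowerSeries.WithPiTopology in
/-- The infinite product `E_j = (q^j; q^j)_∞`, as a formal power series in `q = X` over `ℚ`. -/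
noncomputable def eulerE (j : ℕ) : PowerSeries ℚ :=
  ∏' n : ℕ, (1 - PowerSeries.X ^ (j * (n + 1)))

open scoped PowerSeries.WithPiTopology in
/-- The product defining `E_j` converges for `j ≥ 1`. -/
theorem multipliable_eulerE {j : ℕ} (hj : 1 ≤ j) :
    Multipliable fun n : ℕ => (1 - PowerSeries.X ^ (j * (n + 1)) : PowerSeries ℚ) := by
  simp_rw [sub_eq_add_neg]
  apply PowerSeries.WithPiTopology.multipliable_one_add_of_tendsto_order_atTop_nhds_top
  refine ENat.tendsto_nhds_top_iff_natCast_lt.mpr fun n => ?_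
  filter_upwards [Filter.eventually_ge_atTop n] with m hm
  rw [PowerSeries.order_neg, PowerSeries.order_X_pow]
  exact_mod_cast (by nlinarith : n < j * (m + 1))

/-- Hirschhorn's matrix `m(i, j)`, `i, j ≥ 1`. The first column is `5, 10, 9, 4, 1, 0, 0, …`. Row `0`
and column `0` are `0`, so that in the recursion for the later columns (where subtraction is
truncated) the entries with row index `≤ 0` vanish. -/
def hirschhornM : ℕ → ℕ → ℕ
  | _, 0 => 0
  | 0, _ + 1 => 0
  | 1, 1 => 5
  | 2, 1 => 10
  | 3, 1 => 9
  | 4, 1 => 4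
  | 5, 1 => 1
  | _ + 6, 1 => 0
  | i + 1, j + 2 =>
      25 * hirschhornM (i + 1 - 1) (j + 1) + 25 * hirschhornM (i + 1 - 2) (j + 1)
        + 15 * hirschhornM (i + 1 - 3) (j + 1) + 5 * hirschhornM (i + 1 - 4) (j + 1)
        + hirschhornM (i + 1 - 5) (j + 1)

/-- The upper left `5 × 5` block of the matrix. -/
theorem hirschhornM_block :
    (fun i j : Fin 5 => hirschhornM (i + 1) (j + 1)) =
      !![5, 0, 0, 0, 0;
         2 * 5, 5 ^ 3, 0, 0, 0;
         9, 3 * 5 ^ 3, 5 ^ 5, 0, 0;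
         4, 22 * 5 ^ 2, 4 * 5 ^ 5, 5 ^ 7, 0;
         1, 4 * 5 ^ 3, 8 * 5 ^ 5, 5 ^ 8, 5 ^ 9] := by
  ext i j
  fin_cases i <;> fin_cases j <;> simp [hirschhornM]

theorem hirschhornM_eq_zero_of_row_gt {i j : ℕ} (h : 5 * j < i) : hirschhornM i j = 0 := by
  induction j generalizing i with
  | zero => simp [hirschhornM]
  | succ j ih =>
    cases j with
    | zero =>
      obtain ⟨i, rfl⟩ : ∃ t, i = t + 6 := ⟨i - 6, by omega⟩
      simp [hirschhornM]
    | succ j =>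
      obtain ⟨i, rfl⟩ : ∃ t, i = t + 1 := ⟨i - 1, by omega⟩
      rw [hirschhornM, ih (by omega), ih (by omega), ih (by omega), ih (by omega), ih (by omega)]

/-- The matrix `a(j, k)`, `j, k ≥ 1`. The sums over all `i ≥ 1` in its recursion are written as sums
over `1 ≤ i ≤ 5k`, because `m(6i, i + k) = m(6i + 2, i + k) = 0` for `i > 5k`. -/
def coeffA : ℕ → ℕ → ℕ
  | 0, _ => 0
  | 1, 1 => 10
  | 1, 2 => 125
  | 1, _ => 0
  | j + 2, k =>
      if Odd (j + 1) then
        ∑ i ∈ Finset.Icc 1 (5 * k), coeffA (j + 1) i * hirschhornM (6 * i) (i + k)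
      else
        ∑ i ∈ Finset.Icc 1 (5 * k), coeffA (j + 1) i * hirschhornM (6 * i + 2) (i + k)

/-- The recursion for `a(j, k)` with the sum over all `i ≥ 1`. -/
theorem coeffA_hasSum (j k : ℕ) (hj : 1 ≤ j) :
    HasSum (fun i : ℕ+ => coeffA j i *
      (if Odd j then hirschhornM (6 * i) (i + k) else hirschhornM (6 * i + 2) (i + k)))
      (coeffA (j + 1) k) := by
  obtain ⟨j, rfl⟩ : ∃ t, j = t + 1 := ⟨j - 1, by omega⟩
  have key : coeffA (j + 1 + 1) k = ∑ i ∈ (Finset.Icc 1 (5 * k)).image Nat.toPNat',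
      coeffA (j + 1) i *
        (if Odd (j + 1) then hirschhornM (6 * i) (i + k) else hirschhornM (6 * i + 2) (i + k)) := by
    rw [Finset.sum_image]
    · rw [coeffA]
      split_ifs <;>
      · refine Finset.sum_congr rfl fun i hi => ?_
        have h : ((Nat.toPNat' i : ℕ+) : ℕ) = i := Nat.succ_pred_eq_of_pos (Finset.mem_Icc.mp hi).1
        rw [h]
    · intro x hx y hy h
      have hx' : ((Nat.toPNat' x : ℕ+) : ℕ) = x := Nat.succ_pred_eq_of_pos (Finset.mem_Icc.mp hx).1
      have hy' : ((Nat.toPNat' y : ℕ+) : ℕ) = y := Nat.succ_pred_eq_of_pos (Finset.mem_Icc.mp hy).1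
      rw [← hx', h, hy']
  rw [key]
  refine hasSum_sum_of_ne_finset_zero fun i hi => ?_
  have h : 5 * k < (i : ℕ) := by
    by_contra hc
    exact hi (Finset.mem_image.mpr ⟨i, Finset.mem_Icc.mpr ⟨i.2, by omega⟩, i.coe_toPNat'⟩)
  split_ifs
  · rw [hirschhornM_eq_zero_of_row_gt (by omega), mul_zero]
  · rw [hirschhornM_eq_zero_of_row_gt (by omega), mul_zero]

/-! Let U_r extract the coefficients with index r mod 5 (`quinSect`), and put z = q E_25 / E_1 and s
= q E_5^6 / E_1^6 (`hauptmodul`). The generating function of p_{-2} is E_1^{-2}. Each further power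
of 5 in the progression is one application of some U_r: r = 3 at the start, then 4 and 2
alternately. All series that occur are finite combinations of q^l E_5^x / E_1^y. Since E_1^{-v} =
z^v / (q E_25)^v and U_r treats series in q^5 as scalars, everything reduces to U_0(z^v).

The central fact is U_0(z^i) = Σ_j m(i,j) s^j (`quinSect_zero_pow`). It follows from the modular
equation z^5 = s(q^5) (25 z^4 + 25 z^3 + 15 z^2 + 5 z + 1): applying U_0 to its multiples by powers
of z gives exactly Hirschhorn's recursion, and U_0 of z^{-4}, ..., z^0 supplies the initial values.

For the modular equation (`modular_equation`), residues of pentagonal numbers give E_1 = A(q^5) - q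
E_25 + q^2 C(q^5), and Jacobi's series for E_1^3 forces A C = -E_5^2. The product of E_1 over the
conjugates q ↦ w^k q, with w a primitive fifth root of unity, is then computed twice: from this
dissection as a polynomial in E_1 and q E_25, and from the infinite product as E_5^6 / E_25. -/

namespace ColoredPartition
open PowerSeries

/-! ### Extraction of residue classes modulo 5 -/

section Quinsection
variable {R : Type*} [CommRing R]

/-- The series formed by the coefficients of `f` whose index is `r` modulo `5`. -/
noncomputable def quinSect (r : ℕ) : R⟦X⟧ →ₗ[R] R⟦X⟧ where
  toFun f := mk fun n => coeff (5 * n + r) f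
  map_add' f g := by ext; simp
  map_smul' c f := by ext; simp

@[simp]
lemma coeff_quinSect (r n : ℕ) (f : R⟦X⟧) : coeff n (quinSect r f) = coeff (5 * n + r) f := by
  simp [quinSect]

/-- The substitution `q ↦ q ^ 5`. -/
noncomputable abbrev expand5 : R⟦X⟧ →ₐ[R] R⟦X⟧ := expand 5 (by norm_num)

/-- Exponents in `expand5 f` are multiples of 5, so residue classes are not mixed. This linearity
over series in q^5 is what makes the modular equation a recursion. -/
lemma quinSect_expand_mul {r : ℕ} (hr : r < 5) (f g : R⟦X⟧) :
    quinSect r (expand5 f * g) = f * quinSect r g := by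
  ext n
  simp only [coeff_quinSect, coeff_mul]
  symm
  refine Finset.sum_of_injOn (fun x => (5 * x.1, 5 * x.2 + r)) ?_ ?_ ?_ ?_
  · rintro ⟨a, b⟩ _ ⟨c, d⟩ _ h
    simp only [Prod.mk.injEq] at h
    ext <;> simp <;> omega
  · rintro ⟨a, b⟩ h
    simp only [Finset.mem_coe, Finset.HasAntidiagonal.mem_antidiagonal] at h ⊢
    omega
  · rintro ⟨a, b⟩ h h'
    rw [Finset.HasAntidiagonal.mem_antidiagonal] at h
    dsimp only at h ⊢
    by_cases ha : 5 ∣ a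
    · obtain ⟨a, rfl⟩ := ha
      exact absurd ⟨(a, n - a), by simp; omega, by simp; omega⟩ h'
    · rw [coeff_expand_of_not_dvd _ _ _ ha, zero_mul]
  · rintro ⟨a, b⟩ _
    simp [coeff_expand_mul]

lemma quinSect_X_pow {r : ℕ} (hr : r < 5) (k : ℕ) :
    quinSect r (X ^ k : R⟦X⟧) = if k % 5 = r then X ^ (k / 5) else 0 := by
  ext n
  rw [coeff_quinSect, coeff_X_pow]
  split_ifs with h₁ h₂ h₂
  · rw [coeff_X_pow, if_pos (by omega)]
  · omega
  · rw [coeff_X_pow, if_neg (by omega)]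
  · simp

lemma quinSect_zero_X_pow_mul {r a b : ℕ} (hr : r < 5) (h : a + r = 5 * b) (f : R⟦X⟧) :
    quinSect 0 (X ^ a * f) = X ^ b * quinSect r f := by
  ext n
  rw [coeff_quinSect, coeff_X_pow_mul', coeff_X_pow_mul', coeff_quinSect]
  split_ifs with h₁ h₂ h₂
  · congr 2
    omega
  · omega
  · omega
  · rfl

lemma eq_sum_X_pow_mul_expand (f : R⟦X⟧) :
    f = ∑ r ∈ Finset.range 5, X ^ r * expand5 (quinSect r f) := by
  ext n
  rw [map_sum, Finset.sum_eq_single (n % 5)]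
  · rw [coeff_X_pow_mul', if_pos (Nat.mod_le _ _), coeff_expand, if_pos (by omega), coeff_quinSect]
    congr 2
    omega
  · intro r hr hne
    rw [Finset.mem_range] at hr
    rw [coeff_X_pow_mul']
    split_ifs
    · exact coeff_expand_of_not_dvd _ _ _ (by omega)
    · rfl
  · intro h
    exact absurd (Finset.mem_range.mpr (Nat.mod_lt _ (by norm_num))) h

end Quinsection

/-! ### Truncated products and Euler's product -/

section Products
variable (R : Type*) [CommRing R]

/-- The finite product `(q; q)_n`. -/
noncomputable def qPoch (n : ℕ) : R⟦X⟧ := ∏ i ∈ Finset.range n, (1 - X ^ (i + 1))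

lemma qPoch_zero : qPoch R 0 = 1 := Finset.prod_range_zero _

lemma qPoch_succ (n : ℕ) : qPoch R (n + 1) = qPoch R n * (1 - X ^ (n + 1)) :=
  Finset.prod_range_succ _ _

lemma isUnit_qPoch (n : ℕ) : IsUnit (qPoch R n) := by
  rw [isUnit_iff_constantCoeff, qPoch, map_prod]
  simp

variable {R}

/-- Congruence of power series modulo `X ^ (n + 1)`. -/
def TruncEq (n : ℕ) (f g : R⟦X⟧) : Prop := X ^ (n + 1) ∣ f - g

lemma truncEq_iff {n : ℕ} {f g : R⟦X⟧} :
    TruncEq n f g ↔ ∀ m ≤ n, coeff m f = coeff m g := by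
  simp [TruncEq, X_pow_dvd_iff, sub_eq_zero]

lemma TruncEq.refl (n : ℕ) (f : R⟦X⟧) : TruncEq n f f := by simp [TruncEq]

lemma TruncEq.symm {n : ℕ} {f g : R⟦X⟧} (h : TruncEq n f g) : TruncEq n g f := by
  rw [truncEq_iff] at *
  exact fun m hm => (h m hm).symm

lemma TruncEq.trans {n : ℕ} {f g h : R⟦X⟧} (h₁ : TruncEq n f g) (h₂ : TruncEq n g h) :
    TruncEq n f h := by
  rw [truncEq_iff] at *
  exact fun m hm => (h₁ m hm).trans (h₂ m hm)

lemma TruncEq.mono {n m : ℕ} {f g : R⟦X⟧} (h : TruncEq n f g) (hm : m ≤ n) : TruncEq m f g := by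
  rw [truncEq_iff] at *
  exact fun k hk => h k (hk.trans hm)

lemma TruncEq.mul {n : ℕ} {f g f' g' : R⟦X⟧} (h : TruncEq n f g) (h' : TruncEq n f' g') :
    TruncEq n (f * f') (g * g') := by
  have e : f * f' - g * g' = (f - g) * f' + g * (f' - g') := by ring
  rw [TruncEq, e]
  exact dvd_add (Dvd.dvd.mul_right h _) (Dvd.dvd.mul_left h' _)

lemma TruncEq.pow {n : ℕ} {f g : R⟦X⟧} (h : TruncEq n f g) (k : ℕ) :
    TruncEq n (f ^ k) (g ^ k) :=
  Dvd.dvd.trans h (sub_dvd_pow_sub_pow f g k)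

lemma TruncEq.sum {n : ℕ} {ι : Type*} {s : Finset ι} {f g : ι → R⟦X⟧}
    (h : ∀ i ∈ s, TruncEq n (f i) (g i)) : TruncEq n (∑ i ∈ s, f i) (∑ i ∈ s, g i) := by
  rw [TruncEq, ← Finset.sum_sub_distrib]
  exact Finset.dvd_sum h

lemma TruncEq.prod {n : ℕ} {ι : Type*} {s : Finset ι} {f g : ι → R⟦X⟧}
    (h : ∀ i ∈ s, TruncEq n (f i) (g i)) : TruncEq n (∏ i ∈ s, f i) (∏ i ∈ s, g i) := by
  classical
  induction s using Finset.induction_on with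
  | empty => simpa using TruncEq.refl n 1
  | insert i s hi ih =>
    rw [Finset.prod_insert hi, Finset.prod_insert hi]
    exact (h i (by simp)).mul (ih fun j hj => h j (by simp [hj]))

lemma TruncEq.X_pow_mul {n : ℕ} {f g : R⟦X⟧} (h : TruncEq n f g) (k : ℕ) :
    TruncEq (n + k) (X ^ k * f) (X ^ k * g) := by
  rw [TruncEq, ← mul_sub, show n + k + 1 = k + (n + 1) by ring, pow_add]
  exact mul_dvd_mul_left _ h

lemma TruncEq.of_mul_left {n : ℕ} {u f g : R⟦X⟧} (hu : IsUnit u)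
    (h : TruncEq n (u * f) (u * g)) : TruncEq n f g := by
  rw [TruncEq, ← mul_sub] at h
  exact hu.dvd_mul_left.mp h

lemma TruncEq.expand {n : ℕ} {f g : R⟦X⟧} (h : TruncEq n f g) (k : ℕ) (hk : k ≠ 0) :
    TruncEq n (PowerSeries.expand k hk f) (PowerSeries.expand k hk g) := by
  rw [truncEq_iff] at *
  intro m hm
  rw [coeff_expand, coeff_expand, h _ ((Nat.div_le_self _ _).trans hm)]

lemma TruncEq.rescale {n : ℕ} {f g : R⟦X⟧} (h : TruncEq n f g) (a : R) :
    TruncEq n (PowerSeries.rescale a f) (PowerSeries.rescale a g) := by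
  rw [truncEq_iff] at *
  intro m hm
  rw [coeff_rescale, coeff_rescale, h m hm]

lemma eq_of_forall_truncEq {f g : R⟦X⟧} (h : ∀ n, TruncEq n f g) : f = g := by
  ext n
  exact truncEq_iff.mp (h n) n le_rfl

lemma truncEq_qPoch_of_le {n m : ℕ} (h : n ≤ m) : TruncEq n (qPoch R m) (qPoch R n) := by
  induction m, h using Nat.le_induction with
  | base => exact TruncEq.refl _ _
  | succ m hm ih =>
    refine TruncEq.trans ?_ ih
    rw [TruncEq, qPoch_succ, show qPoch R m * (1 - X ^ (m + 1)) - qPoch R m =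
      X ^ (m + 1) * -qPoch R m by ring]
    exact Dvd.dvd.mul_right (pow_dvd_pow _ (by omega)) _

/-- Euler's pentagonal number theorem in truncated form. It lets product identities be proved for
finite products and sign-and-exponent arguments be made on the series, over any commutative ring and
without a topology. -/
lemma truncEq_pentagonalSeries (n : ℕ) : TruncEq n (pentagonalSeries R) (qPoch R n) := by
  rw [truncEq_iff]
  intro m hm
  have h := (Filter.tendsto_finset_range.eventually
    (coeff_prod_one_sub_X_pow_eventually_eq R m)).and (Filter.eventually_ge_atTop n)
  obtain ⟨N, hN, hn⟩ := h.exists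
  rw [← hN]
  exact truncEq_iff.mp (truncEq_qPoch_of_le hn) m hm

lemma truncEq_qPoch_pentagonalSeries {n m : ℕ} (h : n ≤ m) :
    TruncEq n (qPoch R m) (pentagonalSeries R) :=
  ((truncEq_pentagonalSeries m).mono h).symm

lemma constantCoeff_pentagonalSeries : constantCoeff (pentagonalSeries R) = 1 := by
  have := truncEq_iff.mp (truncEq_pentagonalSeries (R := R) 0) 0 le_rfl
  simpa [qPoch_zero] using this

lemma isUnit_pentagonalSeries : IsUnit (pentagonalSeries R) := by
  rw [isUnit_iff_constantCoeff, constantCoeff_pentagonalSeries]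
  exact isUnit_one

open scoped PowerSeries.WithPiTopology in
lemma eulerE_eq_expand {j : ℕ} (hj : j ≠ 0) :
    eulerE j = expand j hj (pentagonalSeries ℚ) := by
  refine HasProd.tprod_eq ?_
  rw [HasProd, WithPiTopology.tendsto_iff_coeff_tendsto]
  intro n
  apply tendsto_nhds_of_eventually_eq
  filter_upwards [coeff_prod_one_sub_X_pow_eventually_eq ℚ (n / j)] with s hs
  have : ∏ i ∈ s, (1 - X ^ (j * (i + 1)) : ℚ⟦X⟧) = expand j hj (∏ i ∈ s, (1 - X ^ (i + 1))) := by
    simp [map_prod, pow_mul]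
  rw [this, coeff_expand, coeff_expand, hs]

end Products

/-! ### Gaussian binomials and Jacobi's identity for the cube -/

section JacobiCube
variable (R : Type*) [CommRing R]

/-- The Gaussian binomial coefficients, as power series in `q`. -/
noncomputable def qBinom : ℕ → ℕ → R⟦X⟧
  | _, 0 => 1
  | 0, _ + 1 => 0
  | n + 1, m + 1 => qBinom n (m + 1) + X ^ (n - m) * qBinom n m

lemma qBinom_zero_right (n : ℕ) : qBinom R n 0 = 1 := by
  cases n <;> rfl

lemma qBinom_succ_succ (n m : ℕ) :
    qBinom R (n + 1) (m + 1) = qBinom R n (m + 1) + X ^ (n - m) * qBinom R n m := rfl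

lemma qBinom_eq_zero_of_lt {n m : ℕ} (h : n < m) : qBinom R n m = 0 := by
  induction n generalizing m with
  | zero =>
    obtain ⟨m, rfl⟩ : ∃ t, m = t + 1 := ⟨m - 1, by omega⟩
    rfl
  | succ n ih =>
    obtain ⟨m, rfl⟩ : ∃ t, m = t + 1 := ⟨m - 1, by omega⟩
    rw [qBinom_succ_succ, ih (by omega), ih (by omega), mul_zero, add_zero]

lemma qPoch_mul_qBinom {n m : ℕ} (h : m ≤ n) :
    qPoch R m * qPoch R (n - m) * qBinom R n m = qPoch R n := by
  induction n generalizing m with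
  | zero =>
    obtain rfl : m = 0 := by omega
    simp [qPoch_zero, qBinom_zero_right]
  | succ n ih =>
    cases m with
    | zero => simp [qPoch_zero, qBinom_zero_right]
    | succ m =>
      have h₂ := ih (m := m) (by omega)
      rw [qBinom_succ_succ, qPoch_succ, qPoch_succ, Nat.add_sub_add_right]
      obtain ⟨d, rfl⟩ : ∃ d, n = m + d := ⟨n - m, by omega⟩
      rw [Nat.add_sub_cancel_left] at h₂ ⊢
      cases d with
      | zero =>
        rw [qBinom_eq_zero_of_lt R (by omega : m + 0 < m + 1)]
        linear_combination (1 - X ^ (m + 1)) * h₂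
      | succ d =>
        have h₁ := ih (m := m + 1) (by omega)
        rw [show m + (d + 1) - (m + 1) = d by omega] at h₁
        rw [qPoch_succ] at h₁ h₂ ⊢
        linear_combination (1 - X ^ (d + 1)) * h₁ + (X ^ (d + 1)) * (1 - X ^ (m + 1)) * h₂

lemma qBinom_symm {n m : ℕ} (h : m ≤ n) : qBinom R n (n - m) = qBinom R n m := by
  refine ((isUnit_qPoch R m).mul (isUnit_qPoch R (n - m))).mul_left_cancel ?_
  rw [qPoch_mul_qBinom R h, ← qPoch_mul_qBinom R (Nat.sub_le n m), Nat.sub_sub_self h]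
  ring

variable {R}

/-- The `q`-binomial theorem, in homogeneous form. -/
lemma prod_add_mul_pow_eq_sum {A : Type*} [CommRing A] (φ : R⟦X⟧ →+* A) (x y : A) (n : ℕ) :
    ∏ i ∈ Finset.range n, (y + x * φ X ^ i) =
      ∑ m ∈ Finset.range (n + 1), φ (X ^ (m.choose 2) * qBinom R n m) * x ^ m * y ^ (n - m) := by
  induction n with
  | zero => simp [qBinom_zero_right]
  | succ n ih =>
    rw [Finset.prod_range_succ, ih, mul_add, Finset.sum_range_succ' _ (n + 1)]
    have h₁ : (∑ m ∈ Finset.range (n + 1),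
        φ (X ^ (m.choose 2) * qBinom R n m) * x ^ m * y ^ (n - m)) * y =
        ∑ m ∈ Finset.range (n + 1),
        φ (X ^ ((m + 1).choose 2) * qBinom R n (m + 1)) * x ^ (m + 1) * y ^ (n - m) + y ^ (n + 1) := by
      rw [Finset.sum_range_succ', Finset.sum_range_succ, qBinom_eq_zero_of_lt R (Nat.lt_succ_self n),
        add_mul, Finset.sum_mul]
      simp only [Nat.choose_zero_succ, pow_zero, qBinom_zero_right, mul_one, map_one, one_mul,
        Nat.sub_zero, mul_zero, map_zero, zero_mul, add_zero, ← pow_succ]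
      congr 1
      refine Finset.sum_congr rfl fun m hm => ?_
      rw [Finset.mem_range] at hm
      rw [show n - m = n - (m + 1) + 1 by omega, pow_succ]
      ring
    rw [h₁, Finset.sum_mul, add_right_comm, ← Finset.sum_add_distrib]
    congr 1
    · refine Finset.sum_congr rfl fun m hm => ?_
      rw [Finset.mem_range] at hm
      rw [qBinom_succ_succ, Nat.add_sub_add_right, Nat.choose_succ_succ' m 1, Nat.choose_one_right]
      have : φ X ^ n = φ X ^ m * φ X ^ (n - m) := by rw [← pow_add]; congr 1; omega
      rw [this]
      simp only [map_mul, map_add, map_pow]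
      ring
    · simp [qBinom_zero_right]

lemma two_mul_choose_two (m : ℕ) : (2 * m.choose 2 : ℤ) = m * (m - 1) := by
  induction m with
  | zero => simp
  | succ m ih =>
    rw [Nat.choose_succ_succ' m 1, Nat.choose_one_right]
    push_cast
    linarith

/-- Together with `choose_two_add_right`, this shows that the terms m = n + 1 + k and m = n - k of
the expansion below carry the same power of q, with a part independent of k that cancels. -/
lemma choose_two_add_left {n k : ℕ} :
    (n + 1 + k).choose 2 + n * (n - k) = (k + 1).choose 2 + (n.choose 2 + n * (n + 1)) ∨ n < k := by
  rcases lt_or_ge n k with h | h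
  · exact Or.inr h
  · obtain ⟨d, rfl⟩ : ∃ d, n = k + d := ⟨n - k, by omega⟩
    left
    have h₁ := two_mul_choose_two (k + d + 1 + k)
    have h₂ := two_mul_choose_two (k + 1)
    have h₃ := two_mul_choose_two (k + d)
    rw [Nat.add_sub_cancel_left]
    zify
    push_cast at h₁ h₂ h₃
    linarith

lemma choose_two_add_right {n k : ℕ} :
    (n - k).choose 2 + n * (n + 1 + k) = (k + 1).choose 2 + (n.choose 2 + n * (n + 1)) ∨ n < k := by
  rcases lt_or_ge n k with h | h
  · exact Or.inr h
  · obtain ⟨d, rfl⟩ : ∃ d, n = k + d := ⟨n - k, by omega⟩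
    left
    have h₁ := two_mul_choose_two d
    have h₂ := two_mul_choose_two (k + 1)
    have h₃ := two_mul_choose_two (k + d)
    rw [Nat.add_sub_cancel_left]
    zify
    push_cast at h₁ h₂ h₃
    linarith

lemma prod_X_pow_sub_X_pow (n : ℕ) :
    ∏ i ∈ Finset.range n, (X ^ n - X ^ i : R⟦X⟧) = (-1) ^ n * X ^ (n.choose 2) * qPoch R n := by
  have h : ∀ i ∈ Finset.range n, (X ^ n - X ^ i : R⟦X⟧) =
      (-1) * (X ^ i * (1 - X ^ (n - 1 - i + 1))) := by
    intro i hi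
    rw [Finset.mem_range] at hi
    rw [mul_sub, ← pow_add, show i + (n - 1 - i + 1) = n by omega]
    ring
  rw [Finset.prod_congr rfl h, Finset.prod_mul_distrib, Finset.prod_mul_distrib,
    Finset.prod_range_reflect (fun i => (1 - X ^ (i + 1) : R⟦X⟧)), Finset.prod_pow_eq_pow_sum,
    Finset.sum_range_id, ← Nat.choose_two_right]
  simp [qPoch, mul_assoc]

/-- The finite form of Jacobi's identity for the cube of `(q; q)_∞`. -/
lemma qPoch_sq_eq_sum [IsDomain R] (n : ℕ) :
    qPoch R n ^ 2 = ∑ k ∈ Finset.range (n + 1),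
      (-1 : R⟦X⟧) ^ k * (2 * (k : R⟦X⟧) + 1) * X ^ ((k + 1).choose 2) * qBinom R (2 * n + 1) (n + 1 + k) := by
  -- In ∏_{i ≤ 2n} (q^n - x q^i) the factor i = n is q^n (1 - x). Differentiating at x = 1 therefore
  -- leaves only the product of the other factors, which is (q; q)_n^2 up to sign and a power of q.
  have h := congrArg (fun p => Polynomial.eval 1 (Polynomial.derivative p))
    (prod_add_mul_pow_eq_sum (Polynomial.C : R⟦X⟧ →+* Polynomial R⟦X⟧) (-Polynomial.X)
      (Polynomial.C (X ^ n)) (2 * n + 1))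
  set K := n.choose 2 + n * (n + 1) with hK
  have hl : Polynomial.eval 1 (Polynomial.derivative (∏ i ∈ Finset.range (2 * n + 1),
      (Polynomial.C (X ^ n : R⟦X⟧) + -Polynomial.X * Polynomial.C X ^ i))) =
      X ^ K * ((-1) ^ (n + 1) * qPoch R n ^ 2) := by
    rw [show 2 * n + 1 = n + (n + 1) by ring, Finset.prod_range_add, Finset.prod_range_succ']
    have h₀ : Polynomial.C (X ^ n : R⟦X⟧) + -Polynomial.X * Polynomial.C X ^ (n + 0) =
        Polynomial.C (X ^ n) * (1 - Polynomial.X) := by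
      simp only [add_zero, map_pow]
      ring
    rw [h₀, ← mul_assoc, ← mul_assoc, Polynomial.derivative_mul]
    have h₁ : ∏ i ∈ Finset.range n, (X ^ n - X ^ (n + (i + 1)) : R⟦X⟧) =
        X ^ (n * n) * qPoch R n := by
      have : ∀ i ∈ Finset.range n, (X ^ n - X ^ (n + (i + 1)) : R⟦X⟧) =
          X ^ n * (1 - X ^ (i + 1)) := fun i _ => by ring
      rw [Finset.prod_congr rfl this, Finset.prod_mul_distrib, Finset.prod_const,
        Finset.card_range, ← pow_mul, qPoch]
    simp only [Polynomial.eval_add, Polynomial.eval_mul, Polynomial.eval_sub, Polynomial.eval_one,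
      Polynomial.eval_X, sub_self, mul_zero, zero_add, Polynomial.derivative_sub,
      Polynomial.derivative_one, Polynomial.derivative_X, Polynomial.eval_prod,
      Polynomial.eval_neg, Polynomial.eval_C, Polynomial.eval_pow, neg_mul, one_mul, zero_sub,
      ← sub_eq_add_neg]
    rw [prod_X_pow_sub_X_pow, h₁, hK]
    ring
  have hr : Polynomial.eval 1 (Polynomial.derivative (∑ m ∈ Finset.range (2 * n + 1 + 1),
      Polynomial.C (X ^ (m.choose 2) * qBinom R (2 * n + 1) m) * (-Polynomial.X) ^ m *
        Polynomial.C (X ^ n) ^ (2 * n + 1 - m))) =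
      ∑ m ∈ Finset.range (2 * n + 1 + 1), (-1 : R⟦X⟧) ^ m * (m : R⟦X⟧) *
        X ^ (m.choose 2 + n * (2 * n + 1 - m)) * qBinom R (2 * n + 1) m := by
    rw [Polynomial.derivative_sum, Polynomial.eval_finsetSum]
    refine Finset.sum_congr rfl fun m _ => ?_
    rw [neg_pow (Polynomial.X : Polynomial R⟦X⟧), ← Polynomial.C_pow, show Polynomial.C (X ^ (m.choose 2) * qBinom R (2 * n + 1) m) *
      ((-1) ^ m * Polynomial.X ^ m) * Polynomial.C ((X ^ n) ^ (2 * n + 1 - m)) =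
      Polynomial.C ((-1) ^ m * X ^ (m.choose 2 + n * (2 * n + 1 - m)) * qBinom R (2 * n + 1) m) *
        Polynomial.X ^ m by
          simp only [map_mul, map_pow, map_neg, map_one, pow_add, pow_mul]
          ring, Polynomial.derivative_C_mul_X_pow, Polynomial.eval_mul, Polynomial.eval_C,
      Polynomial.eval_pow, Polynomial.eval_X, one_pow]
    ring
  -- The lower half is reflected so that index k pairs m = n - k with m = n + 1 + k. Their signs are
  -- opposite, and the weights combine to 2k + 1.
  rw [hl, hr, show 2 * n + 1 + 1 = (n + 1) + (n + 1) by ring, Finset.sum_range_add,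
    ← Finset.sum_range_reflect, ← Finset.sum_add_distrib] at h
  refine mul_left_cancel₀ (pow_ne_zero K X_ne_zero)
    (mul_left_cancel₀ (pow_ne_zero (n + 1) (neg_ne_zero.mpr one_ne_zero) : (-1 : R⟦X⟧) ^ (n + 1) ≠ 0)
      ?_)
  rw [mul_left_comm, h, Finset.mul_sum, Finset.mul_sum]
  refine Finset.sum_congr rfl fun k hk => ?_
  rw [Finset.mem_range, Nat.lt_succ_iff] at hk
  have e₁ := (choose_two_add_left (n := n) (k := k)).resolve_right (by omega)
  have e₂ := (choose_two_add_right (n := n) (k := k)).resolve_right (by omega)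
  rw [show n + 1 - 1 - k = n - k by omega, show 2 * n + 1 - (n - k) = n + 1 + k by omega,
    show 2 * n + 1 - (n + 1 + k) = n - k by omega, e₁, e₂,
    show n - k = 2 * n + 1 - (n + 1 + k) by omega, qBinom_symm R (by omega),
    show 2 * n + 1 - (n + 1 + k) = n - k by omega]
  obtain ⟨d, rfl⟩ : ∃ d, n = k + d := ⟨n - k, by omega⟩
  rw [Nat.add_sub_cancel_left]
  have e₃ : ((-1 : R⟦X⟧)) ^ d = (-1) ^ (k + d) * (-1) ^ k := by
    rw [pow_add, mul_right_comm, ← mul_pow]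
    simp
  have e₄ : ((-1 : R⟦X⟧)) ^ (k + d + 1 + k) = -((-1) ^ (k + d) * (-1) ^ k) := by ring
  rw [e₃, e₄]
  push_cast
  ring

/-- Jacobi's identity for the cube of `(q; q)_∞`, up to a given degree. -/
lemma truncEq_pentagonalSeries_cube [IsDomain R] (n : ℕ) :
    TruncEq n (pentagonalSeries R ^ 3) (∑ k ∈ Finset.range (n + 1),
      (-1 : R⟦X⟧) ^ k * (2 * (k : R⟦X⟧) + 1) * X ^ ((k + 1).choose 2)) := by
  have h₁ : TruncEq n (pentagonalSeries R ^ 3) (pentagonalSeries R * qPoch R n ^ 2) := by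
    rw [pow_succ' _ 2]
    exact (TruncEq.refl n _).mul ((truncEq_pentagonalSeries n).pow 2)
  refine h₁.trans ?_
  rw [qPoch_sq_eq_sum, Finset.mul_sum]
  refine TruncEq.sum fun k hk => ?_
  rw [Finset.mem_range, Nat.lt_succ_iff] at hk
  -- The quotient (q; q)_{2n+1} E_1 / ((q; q)_{n+1+k} (q; q)_{n-k}) is 1 only up to degree n - k.
  -- The factor q^{k(k+1)/2} makes up for the missing k degrees.
  have h₂ : TruncEq (n - k) (pentagonalSeries R * qBinom R (2 * n + 1) (n + 1 + k)) 1 := by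
    refine TruncEq.of_mul_left (isUnit_pentagonalSeries (R := R)) ?_
    have h := qPoch_mul_qBinom R (by omega : n + 1 + k ≤ 2 * n + 1)
    rw [show 2 * n + 1 - (n + 1 + k) = n - k by omega] at h
    rw [mul_one, ← mul_assoc]
    refine TruncEq.trans (((truncEq_qPoch_pentagonalSeries (by omega : n - k ≤ n + 1 + k)).symm.mul
      (truncEq_pentagonalSeries (n - k))).mul (TruncEq.refl _ _)) ?_
    rw [h]
    exact truncEq_qPoch_pentagonalSeries (by omega)
  have h₃ := ((TruncEq.refl (R := R) _ ((-1 : R⟦X⟧) ^ k * (2 * (k : R⟦X⟧) + 1))).mul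
    (h₂.X_pow_mul ((k + 1).choose 2))).mono (m := n) (by
      have := Nat.choose_succ_succ' k 1
      rw [Nat.choose_one_right] at this
      change (k + 1).choose 2 = _ at this
      omega)
  convert h₃ using 1 <;> ring

/-- Triangular numbers are 0, 1 or 3 modulo 5. -/
lemma quinSect_two_pentagonalSeries_cube [IsDomain R] :
    quinSect 2 (pentagonalSeries R ^ 3) = 0 := by
  ext n
  rw [coeff_quinSect, truncEq_iff.mp (truncEq_pentagonalSeries_cube (5 * n + 2)) _ le_rfl, map_sum,
    map_zero]
  refine Finset.sum_eq_zero fun k _ => ?_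
  have e : ((-1 : R⟦X⟧) ^ k * (2 * (k : R⟦X⟧) + 1)) = C ((-1 : R) ^ k * (2 * (k : R) + 1)) := by
    simp only [map_mul, map_add, map_pow, map_neg, map_one, map_natCast, map_ofNat]
  rw [e, coeff_C_mul, coeff_X_pow, if_neg, mul_zero]
  intro h
  have h₁ : (k + 1) * k = 2 * (5 * n + 2) := by
    rw [h, Nat.choose_two_right, Nat.mul_div_cancel' (Nat.even_mul_pred_self _).two_dvd]
    simp
  have h₂ := congrArg (· % 5) h₁
  have h₃ : k % 5 = 0 ∨ k % 5 = 1 ∨ k % 5 = 2 ∨ k % 5 = 3 ∨ k % 5 = 4 := by omega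
  rcases h₃ with h₃ | h₃ | h₃ | h₃ | h₃ <;> simp [Nat.mul_mod, Nat.add_mod, h₃] at h₂

end JacobiCube

/-! ### The 5-dissection of E_1 and the modular equation -/

section Dissection
variable {R : Type*} [CommRing R]

lemma two_mul_pentagonal_eq_iff {k : ℤ} {n : ℕ} :
    pentagonal k = n ↔ k * (3 * k - 1) = 2 * (n : ℤ) := by
  rw [← two_mul_natCast_pentagonal]
  constructor
  · rintro rfl; rfl
  · intro h
    exact_mod_cast mul_left_cancel₀ two_ne_zero h

lemma int_cases_mod_five (k : ℤ) :
    ∃ m, k = 5 * m ∨ k = 5 * m + 1 ∨ k = 5 * m + 2 ∨ k = 5 * m + 3 ∨ k = 5 * m + 4 :=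
  ⟨k / 5, by omega⟩

lemma quinSect_pentagonalSeries_eq_zero {r : ℕ} (hr : r = 3 ∨ r = 4) :
    quinSect r (pentagonalSeries R) = 0 := by
  ext n
  rw [coeff_quinSect, coeff_pentagonalSeries_eq_zero, map_zero]
  rintro ⟨k, hk⟩
  rw [two_mul_pentagonal_eq_iff] at hk
  obtain ⟨m, rfl | rfl | rfl | rfl | rfl⟩ := int_cases_mod_five k <;>
    ring_nf at hk <;> rcases hr with rfl | rfl <;> push_cast at hk <;> omega

/-- Only k = 5m + 1 gives a pentagonal number that is 1 mod 5, and its value is 1 + 25 m(3m + 1)/2.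
The sign (-1)^{5m+1} = -(-1)^m accounts for the minus. -/
lemma quinSect_one_pentagonalSeries :
    quinSect 1 (pentagonalSeries R) = -expand5 (pentagonalSeries R) := by
  ext n
  rw [coeff_quinSect, map_neg, coeff_expand]
  have key : ∀ k : ℤ, pentagonal k = 5 * n + 1 →
      ∃ m : ℤ, k = 5 * m + 1 ∧ n = 5 * pentagonal (-m) := by
    intro k hk
    rw [two_mul_pentagonal_eq_iff] at hk
    obtain ⟨m, rfl | rfl | rfl | rfl | rfl⟩ := int_cases_mod_five k
    · ring_nf at hk; push_cast at hk; omega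
    · refine ⟨m, rfl, ?_⟩
      have h := two_mul_natCast_pentagonal_neg m
      zify
      push_cast at hk
      linarith
    all_goals ring_nf at hk; push_cast at hk; omega
  by_cases h : ∃ m : ℤ, n = 5 * pentagonal (-m)
  · obtain ⟨m, rfl⟩ := h
    have e : 5 * (5 * pentagonal (-m)) + 1 = pentagonal (5 * m + 1) := by
      have h := two_mul_natCast_pentagonal_neg m
      symm
      rw [two_mul_pentagonal_eq_iff]
      push_cast
      linarith
    rw [e, if_pos (Dvd.intro _ rfl), Nat.mul_div_cancel_left _ (by norm_num),
      coeff_pentagonalSeries_pentagonal, coeff_pentagonalSeries_pentagonal, Int.negOnePow_succ,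
      Int.negOnePow_neg]
    have : Int.negOnePow (5 * m) = Int.negOnePow m := by
      rw [Int.negOnePow_eq_iff]
      exact ⟨2 * m, by ring⟩
    rw [this]
    push_cast
    rfl
  · rw [coeff_pentagonalSeries_eq_zero]
    · split_ifs with h₅
      · rw [coeff_pentagonalSeries_eq_zero, neg_zero]
        rintro ⟨m, hm⟩
        exact h ⟨-m, by rw [neg_neg]; omega⟩
      · rw [neg_zero]
    · rintro ⟨k, hk⟩
      obtain ⟨m, -, hm⟩ := key k hk
      exact h ⟨m, hm⟩

lemma pentagonalSeries_eq_expand_add :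
    pentagonalSeries R = expand5 (quinSect 0 (pentagonalSeries R)) -
      X * expand5 (expand5 (pentagonalSeries R)) +
      X ^ 2 * expand5 (quinSect 2 (pentagonalSeries R)) := by
  conv_lhs => rw [eq_sum_X_pow_mul_expand (pentagonalSeries R)]
  simp only [Finset.sum_range_succ, Finset.sum_range_zero, quinSect_one_pentagonalSeries,
    quinSect_pentagonalSeries_eq_zero (R := R) (Or.inl rfl),
    quinSect_pentagonalSeries_eq_zero (R := R) (Or.inr rfl), map_zero, map_neg]
  ring

lemma constantCoeff_quinSect_zero_pentagonalSeries :
    constantCoeff (quinSect 0 (pentagonalSeries R)) = 1 := by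
  rw [← coeff_zero_eq_constantCoeff_apply, coeff_quinSect, mul_zero, zero_add,
    coeff_zero_eq_constantCoeff_apply, constantCoeff_pentagonalSeries]

lemma quinSect_X_pow_mul_expand {r k : ℕ} (hr : r < 5) (f : R⟦X⟧) :
    quinSect r (X ^ k * expand5 f) = if k % 5 = r then X ^ (k / 5) * f else 0 := by
  rw [mul_comm, quinSect_expand_mul hr, quinSect_X_pow hr]
  split_ifs
  · rw [mul_comm]
  · rw [mul_zero]

/-- In the cube of A - qB + q^2 C, with the three series taken at q^5, the class 2 mod 5 is 3A(AC +
B^2). It vanishes by Jacobi's identity, and 3A can be cancelled since A has constant term 1. -/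
lemma quinSect_zero_mul_quinSect_two_pentagonalSeries [IsDomain R] [CharZero R] :
    quinSect 0 (pentagonalSeries R) * quinSect 2 (pentagonalSeries R) =
      -expand5 (pentagonalSeries R) ^ 2 := by
  have h := quinSect_two_pentagonalSeries_cube (R := R)
  rw [pentagonalSeries_eq_expand_add] at h
  have hA := constantCoeff_quinSect_zero_pentagonalSeries (R := R)
  generalize quinSect 0 (pentagonalSeries R) = A at *
  generalize quinSect 2 (pentagonalSeries R) = C at *
  generalize expand5 (pentagonalSeries R) = B at *
  have e : (expand5 A - X * expand5 B + X ^ 2 * expand5 C) ^ 3 =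
      X ^ 0 * expand5 (A ^ 3) + X ^ 1 * expand5 (-3 * A ^ 2 * B) +
      X ^ 2 * expand5 (3 * A ^ 2 * C + 3 * A * B ^ 2) +
      X ^ 3 * expand5 (-6 * A * B * C - B ^ 3) + X ^ 4 * expand5 (3 * A * C ^ 2 + 3 * B ^ 2 * C) +
      X ^ 5 * expand5 (-3 * B * C ^ 2) + X ^ 6 * expand5 (C ^ 3) := by
    simp only [map_add, map_sub, map_mul, map_pow, map_neg, map_ofNat]
    ring
  rw [e] at h
  simp only [map_add (quinSect 2), quinSect_X_pow_mul_expand (by norm_num : 2 < 5)] at h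
  norm_num at h
  have hA₀ : A ≠ 0 := by
    rintro rfl
    simp at hA
  have h₃ : (3 : R⟦X⟧) ≠ 0 := by
    intro h
    have := congrArg constantCoeff h
    rw [map_ofNat, map_zero] at this
    norm_num at this
  refine mul_left_cancel₀ (mul_ne_zero h₃ hA₀) ?_
  linear_combination h

lemma rescale_expand5 {w : R} (hw : w ^ 5 = 1) (f : R⟦X⟧) :
    rescale w (expand5 f) = expand5 f := by
  ext n
  rw [coeff_rescale, coeff_expand]
  split_ifs with h
  · obtain ⟨m, rfl⟩ := h
    rw [pow_mul, hw, one_pow, one_mul]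
  · rw [mul_zero]

/-- The product over the five conjugates of `y₀ + y₁ + y₂`. -/
lemma prod_conjugates_eq {w a b c : R} (hw : w ^ 4 + w ^ 3 + w ^ 2 + w + 1 = 0)
    (h : a * c = -b ^ 2) :
    ∏ k ∈ Finset.range 5, (a + w ^ k * b + (w ^ k) ^ 2 * c) =
      (a + b + c) * ((a + b + c) ^ 4 - 5 * (a + b + c) ^ 3 * b + 15 * (a + b + c) ^ 2 * b ^ 2 -
        25 * (a + b + c) * b ^ 3 + 25 * b ^ 4) := by
  have h₅ : w ^ 5 = 1 := by linear_combination (w - 1) * hw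
  have h₁₄ : (a + w ^ 1 * b + (w ^ 1) ^ 2 * c) * (a + w ^ 4 * b + (w ^ 4) ^ 2 * c) =
      a ^ 2 + b ^ 2 + c ^ 2 + (a * b + b * c) * (w + w ^ 4) + a * c * (w ^ 2 + w ^ 3) := by
    linear_combination (b ^ 2 + b * c * w ^ 4 + c * b * w + c ^ 2 * (w ^ 5 + 1) + a * c * w ^ 3) * h₅
  have h₂₃ : (a + w ^ 2 * b + (w ^ 2) ^ 2 * c) * (a + w ^ 3 * b + (w ^ 3) ^ 2 * c) =
      a ^ 2 + b ^ 2 + c ^ 2 + (a * b + b * c) * (w ^ 2 + w ^ 3) + a * c * (w + w ^ 4) := by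
    linear_combination (b ^ 2 + b * c * w ^ 3 + c * b * w ^ 2 + c ^ 2 * (w ^ 5 + 1) + a * c * w) * h₅
  -- Complex conjugate factors are paired. The sums w + w^4 and w^2 + w^3 are the two roots of t^2 +
  -- t - 1, so w itself disappears from the result.
  have hs : w ^ 2 + w ^ 3 = -1 - (w + w ^ 4) := by linear_combination hw
  have hp : (w + w ^ 4) ^ 2 = 1 - (w + w ^ 4) := by
    linear_combination hw + (w ^ 3 + 2) * h₅
  rw [hs] at h₁₄ h₂₃
  simp only [Finset.prod_range_succ, Finset.prod_range_zero, one_mul]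
  generalize w + w ^ 4 = φ at *
  set S := a ^ 2 + b ^ 2 + c ^ 2
  calc _ = (a + b + c) * ((a + w ^ 1 * b + (w ^ 1) ^ 2 * c) * (a + w ^ 4 * b + (w ^ 4) ^ 2 * c)) *
        ((a + w ^ 2 * b + (w ^ 2) ^ 2 * c) * (a + w ^ 3 * b + (w ^ 3) ^ 2 * c)) := by ring
    _ = (a + b + c) * (S ^ 2 - S * (a * b + b * c + a * c) - (a * b + b * c) ^ 2 - (a * c) ^ 2 +
        3 * (a * b + b * c) * (a * c)) := by
      rw [h₁₄, h₂₃]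
      linear_combination (a + b + c) * (2 * (a * b + b * c) * (a * c) - (a * b + b * c) ^ 2 -
        (a * c) ^ 2) * hp
    _ = _ := by
      linear_combination (a + b + c) * (5 * a * c - 5 * b ^ 2 - 5 * ((a + c) ^ 2 + b ^ 2) +
        5 * b * (a + c)) * h

lemma prod_one_sub_conjugates {w y : R} (hw : w ^ 4 + w ^ 3 + w ^ 2 + w + 1 = 0) :
    ∏ k ∈ Finset.range 5, (1 - w ^ k * y) = 1 - y ^ 5 := by
  have h₅ : w ^ 5 = 1 := by linear_combination (w - 1) * hw
  have h₁₄ : (1 - w ^ 1 * y) * (1 - w ^ 4 * y) = 1 + y ^ 2 - (w + w ^ 4) * y := by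
    linear_combination y ^ 2 * h₅
  have h₂₃ : (1 - w ^ 2 * y) * (1 - w ^ 3 * y) = 1 + y ^ 2 - (w ^ 2 + w ^ 3) * y := by
    linear_combination y ^ 2 * h₅
  have hs : w ^ 2 + w ^ 3 = -1 - (w + w ^ 4) := by linear_combination hw
  have hp : (w + w ^ 4) ^ 2 = 1 - (w + w ^ 4) := by
    linear_combination hw + (w ^ 3 + 2) * h₅
  rw [hs] at h₂₃
  simp only [Finset.prod_range_succ, Finset.prod_range_zero, one_mul]
  generalize w + w ^ 4 = φ at *
  calc _ = (1 - y) * ((1 - w ^ 1 * y) * (1 - w ^ 4 * y)) * ((1 - w ^ 2 * y) * (1 - w ^ 3 * y)) := by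
        ring
    _ = _ := by
      rw [h₁₄, h₂₃]
      linear_combination -(1 - y) * y ^ 2 * hp

lemma cyclotomic_relation_pow {w : R} (hw : w ^ 4 + w ^ 3 + w ^ 2 + w + 1 = 0) {j : ℕ}
    (hj : ¬ 5 ∣ j) : (w ^ j) ^ 4 + (w ^ j) ^ 3 + (w ^ j) ^ 2 + w ^ j + 1 = 0 := by
  have h₅ : w ^ 5 = 1 := by linear_combination (w - 1) * hw
  have h : w ^ j = w ^ (j % 5) := by
    conv_lhs => rw [← Nat.div_add_mod j 5, pow_add, pow_mul, h₅, one_pow, one_mul]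
  rw [h]
  have : j % 5 = 1 ∨ j % 5 = 2 ∨ j % 5 = 3 ∨ j % 5 = 4 := by omega
  rcases this with h | h | h | h <;> rw [h]
  · linear_combination hw
  · linear_combination hw + (w ^ 3 + w) * h₅
  · linear_combination hw + (w ^ 7 + w ^ 4 + w ^ 2 + w) * h₅
  · linear_combination hw + (w ^ 11 + w ^ 7 + w ^ 6 + w ^ 3 + w ^ 2 + w) * h₅

/-- If 5 divides j, every conjugation fixes q^j. Otherwise w^{jk} runs through all fifth roots of
unity. -/
lemma prod_rescale_one_sub_X_pow {w : R} (hw : w ^ 4 + w ^ 3 + w ^ 2 + w + 1 = 0) (j : ℕ) :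
    ∏ k ∈ Finset.range 5, rescale (w ^ k) (1 - X ^ j) =
      if 5 ∣ j then (1 - X ^ j : R⟦X⟧) ^ 5 else 1 - X ^ (5 * j) := by
  have h₅ : w ^ 5 = 1 := by linear_combination (w - 1) * hw
  have h : ∀ k, rescale (w ^ k) (1 - X ^ j : R⟦X⟧) = 1 - (C w ^ j) ^ k * X ^ j := by
    intro k
    rw [map_sub, map_one, map_pow, rescale_X, mul_pow, map_pow, ← pow_mul, ← pow_mul, mul_comm k j]
  simp only [h]
  split_ifs with hj
  · obtain ⟨j, rfl⟩ := hj
    simp [pow_mul, ← map_pow, h₅]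
  · rw [prod_one_sub_conjugates, ← pow_mul, mul_comm j]
    apply cyclotomic_relation_pow _ hj
    rw [← map_one C]
    simp only [← map_pow, ← map_add, hw, map_zero]

/-- Finite form of ∏_k E_1(w^k q) = E_5^6 / E_25. Each induction step adds five consecutive factors,
exactly the last of which has exponent divisible by 5. -/
lemma prod_rescale_qPoch {w : R} (hw : w ^ 4 + w ^ 3 + w ^ 2 + w + 1 = 0) (n : ℕ) :
    (∏ k ∈ Finset.range 5, rescale (w ^ k) (qPoch R (5 * n))) * expand5 (expand5 (qPoch R n)) =
      expand5 (qPoch R (5 * n)) * expand5 (qPoch R n) ^ 5 := by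
  induction n with
  | zero => simp [qPoch_zero]
  | succ n ih =>
    have hd : ∀ i, i < 4 → ¬ 5 ∣ 5 * n + i + 1 := fun i hi => by omega
    rw [show 5 * (n + 1) = 5 * n + 4 + 1 by ring]
    simp only [show ∀ m, m + 4 = m + 1 + 1 + 1 + 1 from fun m => rfl, qPoch_succ, map_mul,
      Finset.prod_mul_distrib, prod_rescale_one_sub_X_pow hw]
    rw [if_neg (by omega), if_neg (by omega), if_neg (by omega), if_neg (by omega),
      if_pos (by omega)]
    simp only [map_sub, map_one, map_pow, expand_X, ← pow_mul]
    rw [show 5 * n + 1 + 1 + 1 + 1 + 1 = 5 * (n + 1) by ring]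
    linear_combination (1 - X ^ (5 * (5 * n + 1))) * (1 - X ^ (5 * (5 * n + 1 + 1))) *
      (1 - X ^ (5 * (5 * n + 1 + 1 + 1))) * (1 - X ^ (5 * (5 * n + 1 + 1 + 1 + 1))) *
      (1 - X ^ (5 * (n + 1))) ^ 5 * (1 - X ^ (5 * 5 * (n + 1))) * ih

lemma prod_rescale_pentagonalSeries {w : R} (hw : w ^ 4 + w ^ 3 + w ^ 2 + w + 1 = 0) :
    (∏ k ∈ Finset.range 5, rescale (w ^ k) (pentagonalSeries R)) *
      expand5 (expand5 (pentagonalSeries R)) = expand5 (pentagonalSeries R) ^ 6 := by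
  refine eq_of_forall_truncEq fun n => ?_
  have h₁ : TruncEq n (pentagonalSeries R) (qPoch R (5 * n)) :=
    (truncEq_qPoch_pentagonalSeries (by omega)).symm
  have h₂ := truncEq_pentagonalSeries (R := R) n
  have h₃ : TruncEq n (∏ k ∈ Finset.range 5, rescale (w ^ k) (pentagonalSeries R))
      (∏ k ∈ Finset.range 5, rescale (w ^ k) (qPoch R (5 * n))) :=
    TruncEq.prod fun k _ => h₁.rescale (w ^ k)
  have h₄ : TruncEq n (expand5 (pentagonalSeries R)) (expand5 (qPoch R n)) := h₂.expand 5 _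
  have h₅ : TruncEq n (expand5 (pentagonalSeries R)) (expand5 (qPoch R (5 * n))) := h₁.expand 5 _
  have h₆ := h₃.mul (h₄.expand 5 (by norm_num))
  have h₇ := h₅.mul (h₄.pow 5)
  rw [← prod_rescale_qPoch hw, ← pow_succ'] at h₇
  exact h₆.trans h₇.symm

lemma map_pentagonalSeries {S : Type*} [CommRing S] (φ : R →+* S) :
    map φ (pentagonalSeries R) = pentagonalSeries S := by
  refine eq_of_forall_truncEq fun n => ?_
  refine TruncEq.trans ?_ (truncEq_pentagonalSeries n).symm
  have : qPoch S n = map φ (qPoch R n) := by simp [qPoch, map_prod]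
  rw [this, truncEq_iff]
  intro m hm
  rw [coeff_map, coeff_map, truncEq_iff.mp (truncEq_pentagonalSeries n) m hm]

lemma modular_equation_of_root [IsDomain R] [CharZero R] {w : R}
    (hw : w ^ 4 + w ^ 3 + w ^ 2 + w + 1 = 0) {e c : R⟦X⟧} (he : e = pentagonalSeries R)
    (hc : c = X * expand5 (expand5 (pentagonalSeries R))) :
    e * (e ^ 4 + 5 * e ^ 3 * c + 15 * e ^ 2 * c ^ 2 + 25 * e * c ^ 3 + 25 * c ^ 4) *
      expand5 (expand5 (pentagonalSeries R)) = expand5 (pentagonalSeries R) ^ 6 := by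
  have h₅ : w ^ 5 = 1 := by linear_combination (w - 1) * hw
  rw [← prod_rescale_pentagonalSeries hw]
  congr 1
  have hd := pentagonalSeries_eq_expand_add (R := R)
  have hac := congrArg expand5 (quinSect_zero_mul_quinSect_two_pentagonalSeries (R := R))
  have hr : ∀ k, rescale (w ^ k) (pentagonalSeries R) =
      expand5 (quinSect 0 (pentagonalSeries R)) + C w ^ k * -c +
        (C w ^ k) ^ 2 * (X ^ 2 * expand5 (quinSect 2 (pentagonalSeries R))) := by
    intro k
    have hk : (w ^ k) ^ 5 = 1 := by rw [← pow_mul, mul_comm, pow_mul, h₅, one_pow]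
    conv_lhs => rw [hd]
    simp only [map_add, map_sub, map_mul, map_pow (rescale (w ^ k)), rescale_expand5 hk, rescale_X, hc]
    simp only [map_pow]
    ring
  rw [Finset.prod_congr rfl fun k _ => hr k, prod_conjugates_eq, he]
  · have : expand5 (quinSect 0 (pentagonalSeries R)) + -c +
        X ^ 2 * expand5 (quinSect 2 (pentagonalSeries R)) = pentagonalSeries R := by
      conv_rhs => rw [hd]
      rw [hc]
      ring
    rw [this]
    ring
  · rw [← map_one C]
    simp only [← map_pow, ← map_add, hw, map_zero]
  · simp only [map_mul, map_neg, map_pow] at hac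
    rw [hc]
    linear_combination X ^ 2 * hac

/-- The modular equation of level five for `E₁ / (q E₂₅)`, with denominators cleared. -/
lemma modular_equation {e c : ℚ⟦X⟧} (he : e = pentagonalSeries ℚ)
    (hc : c = X * expand5 (expand5 (pentagonalSeries ℚ))) :
    e * (e ^ 4 + 5 * e ^ 3 * c + 15 * e ^ 2 * c ^ 2 + 25 * e * c ^ 3 + 25 * c ^ 4) *
      expand5 (expand5 (pentagonalSeries ℚ)) = expand5 (pentagonalSeries ℚ) ^ 6 := by
  -- The root of unity exists only after extending scalars; the identity descends because its
  -- coefficients are rational.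
  obtain ⟨w, hw⟩ : ∃ w : ℂ, w ^ 4 + w ^ 3 + w ^ 2 + w + 1 = 0 := by
    have h := (Complex.isPrimitiveRoot_exp 5 (by norm_num)).geom_sum_eq_zero (by norm_num)
    simp only [Finset.sum_range_succ, Finset.sum_range_zero] at h
    exact ⟨_, by linear_combination h⟩
  apply map_injective (algebraMap ℚ ℂ) (algebraMap ℚ ℂ).injective
  have h := modular_equation_of_root hw rfl rfl
  subst he hc
  simp only [map_mul, map_add, map_pow, map_ofNat, map_expand, map_pentagonalSeries, map_X]
  exact h

end Dissection

/-! ### Hirschhorn's matrix and the sections of the powers of z -/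

section Hirschhorn

lemma hirschhornM_row_zero (j : ℕ) : hirschhornM 0 j = 0 := by
  cases j <;> simp [hirschhornM]

lemma hirschhornM_col_zero (i : ℕ) : hirschhornM i 0 = 0 := by
  cases i <;> simp [hirschhornM]

lemma hirschhornM_succ_add_two (i j : ℕ) :
    hirschhornM (i + 1) (j + 2) =
      25 * hirschhornM i (j + 1) + 25 * hirschhornM (i - 1) (j + 1) +
        15 * hirschhornM (i - 2) (j + 1) + 5 * hirschhornM (i - 3) (j + 1) +
        hirschhornM (i - 4) (j + 1) := by
  rw [hirschhornM]
  rfl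

lemma hirschhornM_eq_zero_of_lt {i j : ℕ} (h : i < j) : hirschhornM i j = 0 := by
  induction j generalizing i with
  | zero => omega
  | succ j ih =>
    cases i with
    | zero => exact hirschhornM_row_zero _
    | succ i =>
      obtain ⟨j, rfl⟩ : ∃ t, j = t + 1 := ⟨j - 1, by omega⟩
      rw [hirschhornM_succ_add_two, ih (by omega), ih (by omega), ih (by omega), ih (by omega),
        ih (by omega)]

lemma hirschhornM_add_six_one (i : ℕ) : hirschhornM (i + 6) 1 = 0 := by simp [hirschhornM]

/-- The generating polynomial of the `i`-th row of Hirschhorn's matrix. -/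
noncomputable def hirschhornRow (s : ℚ⟦X⟧) (i : ℕ) : ℚ⟦X⟧ :=
  ∑ j ∈ Finset.range (i + 1), (hirschhornM i j : ℚ⟦X⟧) * s ^ j

lemma hirschhornRow_eq_sum_range (s : ℚ⟦X⟧) {i n : ℕ} (h : i < n) :
    hirschhornRow s i = ∑ j ∈ Finset.range n, (hirschhornM i j : ℚ⟦X⟧) * s ^ j := by
  refine Finset.sum_subset (by simpa using h) fun j _ hj => ?_
  rw [Finset.mem_range] at hj
  rw [hirschhornM_eq_zero_of_lt (by omega), Nat.cast_zero, zero_mul]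

/-- From row 6 on the first column is zero, so the matrix recursion accounts for all entries; the
shift by one column is the factor s. -/
lemma hirschhornRow_add_six (s : ℚ⟦X⟧) (i : ℕ) :
    hirschhornRow s (i + 6) = s * (25 * hirschhornRow s (i + 5) + 25 * hirschhornRow s (i + 4) +
      15 * hirschhornRow s (i + 3) + 5 * hirschhornRow s (i + 2) + hirschhornRow s (i + 1)) := by
  rw [hirschhornRow_eq_sum_range s (by omega : i + 6 < i + 6 + 2), Finset.sum_range_succ',
    Finset.sum_range_succ', hirschhornRow_eq_sum_range s (by omega : i + 5 < i + 6 + 1),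
    hirschhornRow_eq_sum_range s (by omega : i + 4 < i + 6 + 1),
    hirschhornRow_eq_sum_range s (by omega : i + 3 < i + 6 + 1),
    hirschhornRow_eq_sum_range s (by omega : i + 2 < i + 6 + 1),
    hirschhornRow_eq_sum_range s (by omega : i + 1 < i + 6 + 1)]
  simp only [Finset.sum_range_succ' _ (i + 6), hirschhornM_col_zero, zero_add,
    hirschhornM_add_six_one, Nat.cast_zero, zero_mul, add_zero]
  simp only [Finset.mul_sum, ← Finset.sum_add_distrib]
  refine Finset.sum_congr rfl fun j _ => ?_
  rw [show i + 6 = i + 5 + 1 from rfl, hirschhornM_succ_add_two]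
  simp only [show i + 5 - 1 = i + 4 by omega, show i + 5 - 2 = i + 3 by omega,
    show i + 5 - 3 = i + 2 by omega, show i + 5 - 4 = i + 1 by omega]
  push_cast
  ring

/-- A sequence that satisfies the recursion of the rows and has the right initial values is given
by the row polynomials. -/
lemma eq_mul_hirschhornRow {s K : ℚ⟦X⟧} {u : ℕ → ℚ⟦X⟧} (h₀ : u 0 = -5 * K) (h₁ : u 1 = 5 * K)
    (h₂ : u 2 = -K) (h₃ : u 3 = -K) (h₄ : u 4 = K)
    (hu : ∀ m, u (m + 5) =
      s * (25 * u (m + 4) + 25 * u (m + 3) + 15 * u (m + 2) + 5 * u (m + 1) + u m)) (i : ℕ) :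
    u (i + 5) = K * hirschhornRow s (i + 1) := by
  have e₀ : u 5 = K * hirschhornRow s 1 := by
    rw [hu 0, h₀, h₁, h₂, h₃, h₄]
    simp [hirschhornRow, Finset.sum_range_succ, hirschhornM]
    ring
  have e₁ : u 6 = K * hirschhornRow s 2 := by
    rw [hu 1, h₁, h₂, h₃, h₄, e₀]
    simp [hirschhornRow, Finset.sum_range_succ, hirschhornM]
    ring
  have e₂ : u 7 = K * hirschhornRow s 3 := by
    rw [hu 2, h₂, h₃, h₄, e₀, e₁]
    simp [hirschhornRow, Finset.sum_range_succ, hirschhornM]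
    ring
  have e₃ : u 8 = K * hirschhornRow s 4 := by
    rw [hu 3, h₃, h₄, e₀, e₁, e₂]
    simp [hirschhornRow, Finset.sum_range_succ, hirschhornM]
    ring
  have e₄ : u 9 = K * hirschhornRow s 5 := by
    rw [hu 4, h₄, e₀, e₁, e₂, e₃]
    simp [hirschhornRow, Finset.sum_range_succ, hirschhornM]
    ring
  induction i using Nat.strong_induction_on with
  | _ i ih =>
    match i with
    | 0 => exact e₀
    | 1 => exact e₁
    | 2 => exact e₂
    | 3 => exact e₃
    | 4 => exact e₄
    | i + 5 =>
      have f₀ := ih i (by omega)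
      have f₁ := ih (i + 1) (by omega)
      have f₂ := ih (i + 2) (by omega)
      have f₃ := ih (i + 3) (by omega)
      have f₄ := ih (i + 4) (by omega)
      rw [show i + 5 + 1 = i + 6 by ring, hirschhornRow_add_six, hu (i + 5)]
      rw [show i + 5 + 4 = i + 4 + 5 by ring, show i + 5 + 3 = i + 3 + 5 by ring,
        show i + 5 + 2 = i + 2 + 5 by ring, show i + 5 + 1 = i + 1 + 5 by ring, f₀, f₁, f₂, f₃, f₄]
      ring

/-- The series `1 / (q; q)_∞`. -/
noncomputable def eulerInv : ℚ⟦X⟧ := (pentagonalSeries ℚ)⁻¹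

lemma pentagonalSeries_mul_eulerInv : pentagonalSeries ℚ * eulerInv = 1 :=
  PowerSeries.mul_inv_cancel _ (by simp [constantCoeff_pentagonalSeries])

lemma expand5_pentagonalSeries_mul_eulerInv :
    expand5 (pentagonalSeries ℚ) * expand5 eulerInv = 1 := by
  rw [← map_mul, pentagonalSeries_mul_eulerInv, map_one]

/-- The series `q E₅⁶ / E₁⁶`. -/
noncomputable def hauptmodul : ℚ⟦X⟧ := X * expand5 (pentagonalSeries ℚ) ^ 6 * eulerInv ^ 6

/-- The terms with exponent divisible by `5` in the powers of `q E₂₅ / E₁`. -/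
theorem quinSect_zero_pow (i : ℕ) :
    quinSect 0 ((X * expand5 (expand5 (pentagonalSeries ℚ)) * eulerInv) ^ (i + 1)) =
      hirschhornRow hauptmodul (i + 1) := by
  obtain ⟨e, he⟩ : ∃ e, e = pentagonalSeries ℚ := ⟨_, rfl⟩
  obtain ⟨c, hc⟩ : ∃ c, c = X * expand5 (expand5 (pentagonalSeries ℚ)) := ⟨_, rfl⟩
  have hmod := modular_equation he hc
  have hdis := pentagonalSeries_eq_expand_add (R := ℚ)
  have hac := quinSect_zero_mul_quinSect_two_pentagonalSeries (R := ℚ)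
  have hed := pentagonalSeries_mul_eulerInv
  have hed₅ := expand5_pentagonalSeries_mul_eulerInv
  have hB₀ : expand5 (pentagonalSeries ℚ) ≠ 0 := left_ne_zero_of_mul_eq_one hed₅
  have hs : expand5 hauptmodul = c ^ 5 * expand5 (expand5 (pentagonalSeries ℚ)) *
      expand5 eulerInv ^ 6 := by
    rw [hauptmodul, hc]
    simp only [map_mul, map_pow, expand_X]
    ring
  rw [← hc]
  generalize expand5 (pentagonalSeries ℚ) = B at *
  generalize quinSect 0 (pentagonalSeries ℚ) = A at *
  generalize quinSect 2 (pentagonalSeries ℚ) = C at *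
  generalize eulerInv = d at *
  rw [← he] at hdis hed
  set z := c * d with hz
  -- The modular equation divided by e^5, using z = c / e.
  have hz₅ : z ^ 5 = expand5 hauptmodul * (25 * z ^ 4 + 25 * z ^ 3 + 15 * z ^ 2 + 5 * z + 1) := by
    have h₁ : e ^ 4 * (25 * z ^ 4 + 25 * z ^ 3 + 15 * z ^ 2 + 5 * z + 1) =
        e ^ 4 + 5 * e ^ 3 * c + 15 * e ^ 2 * c ^ 2 + 25 * e * c ^ 3 + 25 * c ^ 4 := by
      have hez : e * z = c := by rw [hz]; linear_combination c * hed
      rw [← hez]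
      ring
    have h₂ : B ^ 6 * expand5 d ^ 6 = 1 := by rw [← mul_pow, hed₅, one_pow]
    have h₃ : e ^ 5 * d ^ 5 = 1 := by rw [← mul_pow, hed, one_pow]
    rw [hs, hz, mul_pow]
    rw [← h₁] at hmod
    rw [hz] at hmod
    linear_combination -c ^ 5 * d ^ 5 * h₂ - c ^ 5 * expand5 d ^ 6 * d ^ 5 * hmod +
      c ^ 5 * expand5 B * expand5 d ^ 6 * (25 * (c * d) ^ 4 + 25 * (c * d) ^ 3 + 15 * (c * d) ^ 2 +
        5 * (c * d) + 1) * h₃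
  have hez : ∀ m ≤ 4, c * e ^ 4 * z ^ m = c ^ (m + 1) * e ^ (4 - m) := by
    intro m hm
    have h : e ^ m * d ^ m = 1 := by rw [← mul_pow, hed, one_pow]
    rw [← pow_sub_mul_pow e hm, hz, mul_pow]
    linear_combination c ^ (m + 1) * e ^ (4 - m) * h
  -- Since c e^4 = c^5 z^{-4} and c^5 is `expand5 (X * B ^ 5)`, the m-th term is X B^5 times the
  -- section of z^{m-4}. The prefactor makes the negative powers of z genuine power series.
  have hu : ∀ m, quinSect 0 (c * e ^ 4 * z ^ (m + 5)) = hauptmodul *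
      (25 * quinSect 0 (c * e ^ 4 * z ^ (m + 4)) + 25 * quinSect 0 (c * e ^ 4 * z ^ (m + 3)) +
      15 * quinSect 0 (c * e ^ 4 * z ^ (m + 2)) + 5 * quinSect 0 (c * e ^ 4 * z ^ (m + 1)) +
      quinSect 0 (c * e ^ 4 * z ^ m)) := by
    intro m
    have hnat : ∀ (n : ℕ) (f : ℚ⟦X⟧), (n : ℚ⟦X⟧) * quinSect 0 f = quinSect 0 ((n : ℚ⟦X⟧) * f) := by
      intro n f
      rw [← nsmul_eq_mul, ← nsmul_eq_mul, map_nsmul]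
    have h₂₅ := hnat 25
    have h₁₅ := hnat 15
    have h₅ := hnat 5
    push_cast at h₂₅ h₁₅ h₅
    rw [h₂₅, h₂₅, h₁₅, h₅]
    simp only [← map_add]
    rw [← quinSect_expand_mul (by norm_num)]
    congr 1
    rw [pow_add z m 5, hz₅]
    ring
  have key := eq_mul_hirschhornRow (K := X * B ^ 5) (u := fun m => quinSect 0 (c * e ^ 4 * z ^ m))
    ?_ ?_ ?_ ?_ ?_ hu i
  · have hK : (X * B ^ 5 : ℚ⟦X⟧) ≠ 0 := mul_ne_zero X_ne_zero (pow_ne_zero _ hB₀)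
    refine mul_left_cancel₀ hK ?_
    rw [← key, ← quinSect_expand_mul (by norm_num)]
    congr 1
    have h₄ : e ^ 4 * d ^ 4 = 1 := by rw [← mul_pow, hed, one_pow]
    have hz₄ : z ^ 4 = c ^ 4 * d ^ 4 := by rw [hz, mul_pow]
    have hB₅ : expand5 (X * B ^ 5) = c ^ 5 := by
      rw [hc]
      simp only [map_mul, map_pow, expand_X]
      ring
    rw [hB₅, show i + 5 = 4 + (i + 1) by ring, pow_add z 4, hz₄]
    linear_combination -c ^ 5 * z ^ (i + 1) * h₄
  · rw [hez 0 (by norm_num)]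
    -- Only exponents divisible by 5 survive, here X^5 alone. With A C = -B^2 the coefficient B(B^4
    -- + 12 A B^2 C + 6 A^2 C^2) becomes -5 B^5; the next cases are alike.
    have h : c ^ 1 * e ^ (4 - 0) =
        X ^ 1 * expand5 (B * (A ^ 4)) +
        X ^ 2 * expand5 (B * (-4 * A ^ 3 * B)) +
        X ^ 3 * expand5 (B * (6 * A ^ 2 * B ^ 2 + 4 * A ^ 3 * C)) +
        X ^ 4 * expand5 (B * (-4 * A * B ^ 3 - 12 * A ^ 2 * B * C)) +
        X ^ 5 * expand5 (B * (B ^ 4 + 12 * A * B ^ 2 * C + 6 * A ^ 2 * C ^ 2)) +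
        X ^ 6 * expand5 (B * (-4 * B ^ 3 * C - 12 * A * B * C ^ 2)) +
        X ^ 7 * expand5 (B * (6 * B ^ 2 * C ^ 2 + 4 * A * C ^ 3)) +
        X ^ 8 * expand5 (B * (-4 * B * C ^ 3)) +
        X ^ 9 * expand5 (B * (C ^ 4)) := by
      rw [hdis, hc]
      simp only [map_add, map_sub, map_mul, map_pow, map_neg, map_ofNat]
      ring
    rw [h]
    simp only [map_add (quinSect 0), quinSect_X_pow_mul_expand (by norm_num : 0 < 5)]
    norm_num
    linear_combination X * B * (6 * A * C + 6 * B ^ 2) * hac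
  · rw [hez 1 (by norm_num)]
    have h : c ^ 2 * e ^ (4 - 1) =
        X ^ 2 * expand5 (B ^ 2 * (A ^ 3)) +
        X ^ 3 * expand5 (B ^ 2 * (-3 * A ^ 2 * B)) +
        X ^ 4 * expand5 (B ^ 2 * (3 * A * B ^ 2 + 3 * A ^ 2 * C)) +
        X ^ 5 * expand5 (B ^ 2 * (-B ^ 3 - 6 * A * B * C)) +
        X ^ 6 * expand5 (B ^ 2 * (3 * B ^ 2 * C + 3 * A * C ^ 2)) +
        X ^ 7 * expand5 (B ^ 2 * (-3 * B * C ^ 2)) +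
        X ^ 8 * expand5 (B ^ 2 * (C ^ 3)) := by
      rw [hdis, hc]
      simp only [map_add, map_sub, map_mul, map_pow, map_neg, map_ofNat]
      ring
    rw [h]
    simp only [map_add (quinSect 0), quinSect_X_pow_mul_expand (by norm_num : 0 < 5)]
    norm_num
    linear_combination -6 * X * B ^ 3 * hac
  · rw [hez 2 (by norm_num)]
    have h : c ^ 3 * e ^ (4 - 2) =
        X ^ 3 * expand5 (B ^ 3 * (A ^ 2)) +
        X ^ 4 * expand5 (B ^ 3 * (-2 * A * B)) +
        X ^ 5 * expand5 (B ^ 3 * (B ^ 2 + 2 * A * C)) +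
        X ^ 6 * expand5 (B ^ 3 * (-2 * B * C)) +
        X ^ 7 * expand5 (B ^ 3 * (C ^ 2)) := by
      rw [hdis, hc]
      simp only [map_add, map_mul, map_pow, map_neg, map_ofNat]
      ring
    rw [h]
    simp only [map_add (quinSect 0), quinSect_X_pow_mul_expand (by norm_num : 0 < 5)]
    norm_num
    linear_combination 2 * X * B ^ 3 * hac
  · rw [hez 3 (by norm_num)]
    have h : c ^ 4 * e ^ (4 - 3) =
        X ^ 4 * expand5 (B ^ 4 * (A)) +
        X ^ 5 * expand5 (B ^ 4 * (-B)) +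
        X ^ 6 * expand5 (B ^ 4 * (C)) := by
      rw [hdis, hc]
      simp only [map_mul, map_pow, map_neg]
      ring
    rw [h]
    simp only [map_add (quinSect 0), quinSect_X_pow_mul_expand (by norm_num : 0 < 5)]
    norm_num
    ring
  · rw [hez 4 (by norm_num)]
    have h : c ^ 5 * e ^ (4 - 4) =
        X ^ 5 * expand5 (B ^ 5 * (1)) := by
      rw [hdis, hc]
      simp only [map_mul, map_pow, map_one]
      ring
    rw [h]
    simp only [quinSect_X_pow_mul_expand (by norm_num : 0 < 5)]
    norm_num

end Hirschhorn

/-! ### The generating function of two-coloured partitions -/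

section GeneratingFunction

open scoped PowerSeries.WithPiTopology in
lemma mk_card_partition_eq_eulerInv :
    (mk fun n => (Fintype.card n.Partition : ℚ)) = eulerInv := by
  have h₁ := (Nat.Partition.hasProd_powerSeriesMk_card_restricted ℚ fun _ => True).mul
    (WithPiTopology.hasProd_one_sub_X_pow ℚ)
  -- Each geometric series in the partition product cancels the matching factor of Euler's product.
  have h₂ : ∀ i : ℕ, (if True then ∑' j : ℕ, (X : ℚ⟦X⟧) ^ ((i + 1) * j) else 1) *
      (1 - X ^ (i + 1)) = 1 := by
    intro i
    simp only [if_true, pow_mul]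
    exact WithPiTopology.tsum_pow_mul_one_sub_of_constantCoeff_eq_zero (by simp)
  simp only [h₂] at h₁
  have h₃ := h₁.unique hasProd_one
  simp only [Nat.Partition.restricted, imp_true_iff, Finset.filter_true, Finset.card_univ] at h₃
  calc _ = (mk fun n => (Fintype.card n.Partition : ℚ)) * (pentagonalSeries ℚ * eulerInv) := by
        rw [pentagonalSeries_mul_eulerInv, mul_one]
    _ = _ := by rw [← mul_assoc, h₃, one_mul]

/-- The coloured partition with parts `p.1` of the first and `p.2` of the second colour. -/
def unionColors (p : Multiset ℕ × Multiset ℕ) : Multiset (ℕ × Fin 2) :=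
  p.1.map (fun a => (a, 0)) + p.2.map fun a => (a, 1)

lemma unionColors_injective : Function.Injective unionColors := by
  have h₀ : ∀ p, ((unionColors p).filter fun x => x.2 = 0).map Prod.fst = p.1 := by
    intro p
    simp [unionColors, Multiset.filter_add, Multiset.filter_map]
  have h₁ : ∀ p, ((unionColors p).filter fun x => x.2 = 1).map Prod.fst = p.2 := by
    intro p
    simp [unionColors, Multiset.filter_add, Multiset.filter_map]
  intro p q h
  ext1
  · rw [← h₀ p, ← h₀ q, h]
  · rw [← h₁ p, ← h₁ q, h]

lemma exists_unionColors_eq (s : Multiset (ℕ × Fin 2)) : ∃ p, unionColors p = s := by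
  induction s using Multiset.induction_on with
  | empty => exact ⟨(0, 0), by simp [unionColors]⟩
  | cons x s ih =>
    obtain ⟨p, rfl⟩ := ih
    obtain ⟨a, i⟩ := x
    fin_cases i
    · exact ⟨(a ::ₘ p.1, p.2), by simp [unionColors]⟩
    · exact ⟨(p.1, a ::ₘ p.2), by simp [unionColors]⟩

lemma isColoredPartition_unionColors {n : ℕ} {p : Multiset ℕ × Multiset ℕ} :
    IsColoredPartition 2 n (unionColors p) ↔
      (∀ x ∈ p.1, 0 < x) ∧ (∀ x ∈ p.2, 0 < x) ∧ p.1.sum + p.2.sum = n := by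
  simp only [IsColoredPartition, unionColors, Multiset.mem_add, Multiset.mem_map, Multiset.map_add,
    Multiset.map_map, Function.comp_def, Multiset.map_id', Multiset.sum_add]
  constructor
  · rintro ⟨h, hs⟩
    exact ⟨fun x hx => h (x, 0) (Or.inl ⟨x, hx, rfl⟩), fun x hx => h (x, 1) (Or.inr ⟨x, hx, rfl⟩), hs⟩
  · rintro ⟨h₀, h₁, hs⟩
    refine ⟨?_, hs⟩
    rintro _ (⟨x, hx, rfl⟩ | ⟨x, hx, rfl⟩)
    exacts [h₀ x hx, h₁ x hx]

lemma coloredPartitionCount_two (n : ℕ) :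
    coloredPartitionCount 2 n = ∑ x ∈ Finset.HasAntidiagonal.antidiagonal n,
      Fintype.card x.1.Partition * Fintype.card x.2.Partition := by
  classical
  let S : Finset (Σ x : ℕ × ℕ, x.1.Partition × x.2.Partition) :=
    (Finset.HasAntidiagonal.antidiagonal n).sigma fun _ => Finset.univ
  let F : (Σ x : ℕ × ℕ, x.1.Partition × x.2.Partition) → Multiset (ℕ × Fin 2) :=
    fun y => unionColors (y.2.1.parts, y.2.2.parts)
  have hF : Function.Injective F := by
    rintro ⟨⟨a, b⟩, p, q⟩ ⟨⟨a', b'⟩, p', q'⟩ h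
    have h' := unionColors_injective h
    simp only [Prod.mk.injEq] at h'
    obtain rfl : a = a' := p.parts_sum.symm.trans ((congrArg _ h'.1).trans p'.parts_sum)
    obtain rfl : b = b' := q.parts_sum.symm.trans ((congrArg _ h'.2).trans q'.parts_sum)
    rw [Nat.Partition.ext h'.1, Nat.Partition.ext h'.2]
  have hS : {s : Multiset (ℕ × Fin 2) | IsColoredPartition 2 n s} = ↑(S.image F) := by
    ext s
    simp only [Set.mem_ofPred_eq, Finset.coe_image, Set.mem_image, Finset.mem_coe]
    constructor
    · intro h
      obtain ⟨p, rfl⟩ := exists_unionColors_eq s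
      obtain ⟨h₀, h₁, hs⟩ := isColoredPartition_unionColors.mp h
      refine ⟨⟨(p.1.sum, p.2.sum), ⟨p.1, fun hi => h₀ _ hi, rfl⟩, ⟨p.2, fun hi => h₁ _ hi, rfl⟩⟩, ?_, rfl⟩
      simp [S, hs]
    · rintro ⟨⟨⟨a, b⟩, p, q⟩, hy, rfl⟩
      refine isColoredPartition_unionColors.mpr ⟨fun x hx => p.parts_pos hx, fun x hx => q.parts_pos hx, ?_⟩
      simpa [S, p.parts_sum, q.parts_sum] using hy
  rw [coloredPartitionCount, hS, Set.ncard_coe_finset, Finset.card_image_of_injective _ hF,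
    Finset.card_sigma]
  simp

/-- The generating function of the two-coloured partitions is `1 / (q; q)_∞²`. -/
theorem mk_coloredPartitionCount_two :
    (mk fun n => (coloredPartitionCount 2 n : ℚ)) = eulerInv ^ 2 := by
  rw [← mk_card_partition_eq_eulerInv, sq]
  ext n
  rw [coeff_mk, coeff_mul, coloredPartitionCount_two]
  push_cast
  simp only [coeff_mk]

end GeneratingFunction

/-! ### Passage from one power of 5 to the next -/

section Iteration

/-- The series `q ^ l E₅ ^ (6l + 4 + d) / E₁ ^ (6l + 6 + d)`. -/
noncomputable def basisTerm (d l : ℕ) : ℚ⟦X⟧ :=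
  X ^ l * expand5 (pentagonalSeries ℚ) ^ (6 * l + 4 + d) * eulerInv ^ (6 * l + 6 + d)

/-- The powers q^a and q^c together supply the q^{v+1} needed to write E_1^{-(v+1)} as z^{v+1} /
E_25^{v+1}. What is left besides z^{v+1} is a series in q^5 and comes out of the section; E_25
becomes E_5. -/
lemma X_pow_mul_quinSect_mul_eulerInv_pow {r a b v : ℕ} (hr : r < 5) (hab : a + r = 5 * b)
    (c : ℕ) (g : ℚ⟦X⟧) (hv : a + c = v + 1) :
    X ^ b * quinSect r (X ^ c * expand5 g * eulerInv ^ (v + 1)) =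
      g * expand5 eulerInv ^ (v + 1) * hirschhornRow hauptmodul (v + 1) := by
  rw [← quinSect_zero_X_pow_mul hr hab, ← quinSect_zero_pow, ← quinSect_expand_mul (by norm_num)]
  congr 1
  have h : expand5 (expand5 (pentagonalSeries ℚ)) ^ (v + 1) * expand5 (expand5 eulerInv) ^ (v + 1) =
      1 := by
    rw [← mul_pow, ← map_mul, expand5_pentagonalSeries_mul_eulerInv, map_one, one_pow]
  simp only [map_mul, map_pow, mul_pow]
  rw [← hv] at h ⊢
  rw [pow_add X a c]
  linear_combination -X ^ a * X ^ c * expand5 g * eulerInv ^ (a + c) * h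

lemma quinSect_three_eulerInv_sq :
    quinSect 3 (eulerInv ^ 2) = 10 * basisTerm 0 0 + 125 * basisTerm 0 1 := by
  have h := X_pow_mul_quinSect_mul_eulerInv_pow (r := 3) (a := 2) (b := 1) (v := 1) (by norm_num)
    (by norm_num) 0 1 (by norm_num)
  rw [map_one, pow_zero, one_mul, one_mul, one_mul] at h
  refine mul_left_cancel₀ (pow_ne_zero 1 X_ne_zero) (h.trans ?_)
  have hed := expand5_pentagonalSeries_mul_eulerInv
  have h₂ : expand5 (pentagonalSeries ℚ) ^ 2 * expand5 eulerInv ^ 2 = 1 := by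
    rw [← mul_pow, hed, one_pow]
  simp [hirschhornRow, Finset.sum_range_succ, hirschhornM, basisTerm, hauptmodul]
  generalize expand5 (pentagonalSeries ℚ) = B at *
  linear_combination (10 * X * B ^ 4 * eulerInv ^ 6 + 125 * X ^ 2 * B ^ 10 * eulerInv ^ 12) * h₂

/-- Row v = 6l + 6 + d starts only at column l + 2, because m(v, j) = 0 for v > 5j. So s^{l+2} can
be split off, and d + d' = 2 is what makes the remaining exponents those of `basisTerm d'`. -/
lemma quinSect_basisTerm {r d d' : ℕ} (hr : r + d = 4) (hd : d + d' = 2) (l : ℕ) :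
    quinSect r (basisTerm d l) = ∑ k ∈ Finset.range (5 * l + 5 + d),
      (hirschhornM (6 * (l + 1) + d) (l + 1 + (k + 1)) : ℚ⟦X⟧) * basisTerm d' k := by
  have h := X_pow_mul_quinSect_mul_eulerInv_pow (r := r) (a := 5 * l + 6 + d) (b := l + 2)
    (v := 6 * l + 5 + d) (by omega) (by omega) l (pentagonalSeries ℚ ^ (6 * l + 4 + d)) (by omega)
  rw [map_pow, show 6 * l + 5 + d + 1 = 6 * l + 6 + d by ring] at h
  refine mul_left_cancel₀ (pow_ne_zero (l + 2) X_ne_zero) (h.trans ?_)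
  rw [hirschhornRow, show 6 * l + 6 + d + 1 = (l + 2) + (5 * l + 5 + d) by ring,
    Finset.sum_range_add, Finset.sum_eq_zero, zero_add, Finset.mul_sum, Finset.mul_sum]
  · refine Finset.sum_congr rfl fun k _ => ?_
    have h₁ : pentagonalSeries ℚ ^ (6 * l + 4 + d) * eulerInv ^ (6 * l + 4 + d) = 1 := by
      rw [← mul_pow, pentagonalSeries_mul_eulerInv, one_pow]
    have h₂ : expand5 (pentagonalSeries ℚ) ^ (6 * l + 6 + d) * expand5 eulerInv ^ (6 * l + 6 + d) =
        1 := by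
      rw [← mul_pow, expand5_pentagonalSeries_mul_eulerInv, one_pow]
    have h₃ : hauptmodul ^ (l + 2 + k) = X ^ (l + 2) * X ^ k *
        (expand5 (pentagonalSeries ℚ) ^ (6 * l + 6 + d) *
          expand5 (pentagonalSeries ℚ) ^ (6 * k + 4 + d')) *
        (eulerInv ^ (6 * l + 4 + d) * eulerInv ^ (6 * k + 6 + d')) := by
      rw [hauptmodul, mul_pow, mul_pow, ← pow_mul, ← pow_mul, ← pow_add, ← pow_add, ← pow_add]
      congr 3 <;> omega
    rw [h₃, basisTerm, show 6 * (l + 1) + d = 6 * l + 6 + d by ring,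
      show l + 1 + (k + 1) = l + 2 + k by ring]
    generalize expand5 (pentagonalSeries ℚ) = B at *
    generalize (hirschhornM (6 * l + 6 + d) (l + 2 + k) : ℚ⟦X⟧) = M
    set Y := M * X ^ (l + 2) * X ^ k * B ^ (6 * k + 4 + d') * eulerInv ^ (6 * k + 6 + d')
    calc _ = Y * (pentagonalSeries ℚ ^ (6 * l + 4 + d) * eulerInv ^ (6 * l + 4 + d)) *
          (B ^ (6 * l + 6 + d) * expand5 eulerInv ^ (6 * l + 6 + d)) := by
          simp only [Y]; ring
      _ = _ := by rw [h₁, h₂]; simp only [Y]; ring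
  · intro j hj
    rw [Finset.mem_range] at hj
    rw [hirschhornM_eq_zero_of_row_gt (by omega), Nat.cast_zero, zero_mul]

lemma sum_Icc_one_eq_sum_range {M : Type*} [AddCommMonoid M] (f : ℕ → M) (n : ℕ) :
    ∑ i ∈ Finset.Icc 1 n, f i = ∑ i ∈ Finset.range n, f (i + 1) := by
  induction n with
  | zero => simp
  | succ n ih => rw [Finset.sum_Icc_succ_top (by omega), ih, Finset.sum_range_succ]

/-- `f` is the finite sum of the terms `a (l + 1)` times `basisTerm d l`. -/
def IsExpansion (a : ℕ → ℕ) (d : ℕ) (f : ℚ⟦X⟧) : Prop :=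
  ∃ N, (∀ l, N ≤ l → a (l + 1) = 0) ∧
    f = ∑ l ∈ Finset.range N, (a (l + 1) : ℚ⟦X⟧) * basisTerm d l

lemma IsExpansion.quinSect {a a' : ℕ → ℕ} {r d d' : ℕ} {f : ℚ⟦X⟧} (h : IsExpansion a d f)
    (hr : r + d = 4) (hd : d + d' = 2)
    (ha : ∀ k, a' k = ∑ i ∈ Finset.Icc 1 (5 * k), a i * hirschhornM (6 * i + d) (i + k)) :
    IsExpansion a' d' (quinSect r f) := by
  obtain ⟨N, hN, rfl⟩ := h
  have ha' : ∀ k, a' (k + 1) = ∑ l ∈ Finset.range N,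
      a (l + 1) * hirschhornM (6 * (l + 1) + d) (l + 1 + (k + 1)) := by
    intro k
    rw [ha, sum_Icc_one_eq_sum_range
      (fun i => a i * hirschhornM (6 * i + d) (i + (k + 1)))]
    rcases le_total N (5 * (k + 1)) with hk | hk
    · refine (Finset.sum_subset (by simpa using hk) fun l _ hl => ?_).symm
      rw [hN l (by simpa using hl), zero_mul]
    · refine Finset.sum_subset (by simpa using hk) fun l _ hl => ?_
      rw [Finset.mem_range] at hl
      rw [hirschhornM_eq_zero_of_row_gt (by omega), mul_zero]
  -- For i ≤ N and k > 5N + d the entry m(6i + d, i + k) lies above the diagonal and vanishes.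
  refine ⟨5 * N + d, fun k hk => ?_, ?_⟩
  · rw [ha']
    refine Finset.sum_eq_zero fun l hl => ?_
    rw [Finset.mem_range] at hl
    rw [hirschhornM_eq_zero_of_lt (by omega), mul_zero]
  · simp only [ha', Nat.cast_sum, Finset.sum_mul]
    rw [Finset.sum_comm, map_sum]
    refine Finset.sum_congr rfl fun l hl => ?_
    rw [Finset.mem_range] at hl
    rw [← nsmul_eq_mul, map_nsmul, quinSect_basisTerm hr hd, nsmul_eq_mul, Finset.mul_sum]
    refine (Finset.sum_subset (by simp; omega) fun k _ hk => ?_).trans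
      (Finset.sum_congr rfl fun k _ => ?_)
    · rw [Finset.mem_range] at hk
      rw [hirschhornM_eq_zero_of_lt (by omega), Nat.cast_zero, zero_mul, mul_zero]
    · push_cast
      ring

lemma coeffA_succ {j d : ℕ} (hj : 1 ≤ j) (hd : d = if Odd j then 0 else 2) (k : ℕ) :
    coeffA (j + 1) k =
      ∑ i ∈ Finset.Icc 1 (5 * k), coeffA j i * hirschhornM (6 * i + d) (i + k) := by
  obtain ⟨j, rfl⟩ : ∃ t, j = t + 1 := ⟨j - 1, by omega⟩
  rw [coeffA, hd]
  split_ifs <;> rfl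

lemma quinSect_mk_coloredPartitionCount (p t r : ℕ) :
    quinSect r (mk fun n => (coloredPartitionCount 2 (p * n + t) : ℚ)) =
      mk fun n => (coloredPartitionCount 2 (5 * p * n + (p * r + t)) : ℚ) := by
  ext n
  rw [coeff_quinSect, coeff_mk, coeff_mk]
  congr 2
  ring

lemma isExpansion_odd_and_even (j : ℕ) :
    IsExpansion (coeffA (2 * j + 1)) 0 (mk fun n => (coloredPartitionCount 2
      (5 ^ (2 * j + 1) * n + (7 * 5 ^ (2 * j + 1) + 1) / 12) : ℚ)) ∧
    IsExpansion (coeffA (2 * j + 2)) 2 (mk fun n => (coloredPartitionCount 2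
      (5 ^ (2 * j + 2) * n + (11 * 5 ^ (2 * j + 2) + 1) / 12) : ℚ)) := by
  have step : ∀ j, IsExpansion (coeffA (2 * j + 1)) 0 (mk fun n => (coloredPartitionCount 2
      (5 ^ (2 * j + 1) * n + (7 * 5 ^ (2 * j + 1) + 1) / 12) : ℚ)) →
      IsExpansion (coeffA (2 * j + 2)) 2 (mk fun n => (coloredPartitionCount 2
      (5 ^ (2 * j + 2) * n + (11 * 5 ^ (2 * j + 2) + 1) / 12) : ℚ)) := by
    intro j h
    have h' := h.quinSect (r := 4) (d' := 2) rfl rfl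
      (coeffA_succ (by omega) (by rw [if_pos (odd_two_mul_add_one j)]))
    rw [quinSect_mk_coloredPartitionCount] at h'
    have e₁ : 5 ^ (2 * j + 2) = 5 * 5 ^ (2 * j + 1) := pow_succ' 5 (2 * j + 1)
    -- The residue r = 4 is forced by 11 · 5 = 4 · 12 + 7; in the other step 7 · 5 = 2 · 12 + 11
    -- gives r = 2.
    have e₂ : (11 * 5 ^ (2 * j + 2) + 1) / 12 =
        5 ^ (2 * j + 1) * 4 + (7 * 5 ^ (2 * j + 1) + 1) / 12 := by omega
    rw [e₂, e₁]
    exact h'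
  induction j with
  | zero =>
    have h₁ : IsExpansion (coeffA (2 * 0 + 1)) 0 (mk fun n => (coloredPartitionCount 2
        (5 ^ (2 * 0 + 1) * n + (7 * 5 ^ (2 * 0 + 1) + 1) / 12) : ℚ)) := by
      refine ⟨2, fun l hl => ?_, ?_⟩
      · obtain ⟨l, rfl⟩ : ∃ t, l = t + 2 := ⟨l - 2, by omega⟩
        simp [coeffA]
      · have h := quinSect_mk_coloredPartitionCount 1 0 3
        simp only [one_mul, add_zero] at h
        rw [mk_coloredPartitionCount_two, quinSect_three_eulerInv_sq] at h
        norm_num at h ⊢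
        rw [← h]
        simp [Finset.sum_range_succ, coeffA]
    exact ⟨h₁, step 0 h₁⟩
  | succ j ih =>
    have h : IsExpansion (coeffA (2 * (j + 1) + 1)) 0 (mk fun n => (coloredPartitionCount 2
        (5 ^ (2 * (j + 1) + 1) * n + (7 * 5 ^ (2 * (j + 1) + 1) + 1) / 12) : ℚ)) := by
      have hn : ¬ Odd (2 * j + 2) := by
        rw [Nat.not_odd_iff_even]
        exact ⟨j + 1, by ring⟩
      have h' := ih.2.quinSect (r := 2) (d' := 0) rfl rfl
        (coeffA_succ (by omega) (by rw [if_neg hn]))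
      rw [quinSect_mk_coloredPartitionCount] at h'
      have e₁ : 5 ^ (2 * (j + 1) + 1) = 5 * 5 ^ (2 * j + 2) := pow_succ' 5 (2 * j + 2)
      have e₂ : (7 * 5 ^ (2 * (j + 1) + 1) + 1) / 12 =
          5 ^ (2 * j + 2) * 2 + (11 * 5 ^ (2 * j + 2) + 1) / 12 := by omega
      rw [e₂, e₁]
      exact h'
    exact ⟨h, step _ h⟩

open scoped PowerSeries.WithPiTopology in
lemma IsExpansion.hasSum {a : ℕ → ℕ} {d : ℕ} {f : ℚ⟦X⟧} (h : IsExpansion a d f) :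
    HasSum (fun l : ℕ+ => (a l : ℚ⟦X⟧) * basisTerm d ((l : ℕ) - 1)) f := by
  obtain ⟨N, hN, rfl⟩ := h
  rw [← Equiv.pnatEquivNat.symm.hasSum_iff]
  refine hasSum_sum_of_ne_finset_zero (f := fun l => (a (l + 1) : ℚ⟦X⟧) * basisTerm d l)
    (s := Finset.range N) ?_
  intro l hl
  rw [hN l (by simpa using hl), Nat.cast_zero, zero_mul]

lemma eulerE_one : eulerE 1 = pentagonalSeries ℚ := by
  rw [eulerE_eq_expand one_ne_zero, expand_one_apply]

lemma inv_eulerE_one_pow (n : ℕ) : (eulerE 1 ^ n)⁻¹ = eulerInv ^ n := by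
  rw [eulerE_one, PowerSeries.inv_eq_iff_mul_eq_one
    (by rw [map_pow, constantCoeff_pentagonalSeries, one_pow]; exact one_ne_zero), ← mul_pow,
    mul_comm, pentagonalSeries_mul_eulerInv, one_pow]

end Iteration
end ColoredPartition

/-! ### The theorem -/

open scoped PowerSeries.WithPiTopology in
theorem theorem4p1 (j : ℕ) (hj : 1 ≤ j) :
    HasSum
      (fun l : ℕ+ => (coeffA (2 * j - 1) l : PowerSeries ℚ) * PowerSeries.X ^ ((l : ℕ) - 1) *
        (eulerE 5 ^ (6 * (l : ℕ) - 2) * (eulerE 1 ^ (6 * (l : ℕ)))⁻¹))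
      (PowerSeries.mk fun n : ℕ =>
        (coloredPartitionCount 2
          (5 ^ (2 * j - 1) * n + (7 * 5 ^ (2 * j - 1) + 1) / 12) : ℚ)) ∧
    HasSum
      (fun l : ℕ+ => (coeffA (2 * j) l : PowerSeries ℚ) * PowerSeries.X ^ ((l : ℕ) - 1) *
        (eulerE 5 ^ (6 * (l : ℕ)) * (eulerE 1 ^ (6 * (l : ℕ) + 2))⁻¹))
      (PowerSeries.mk fun n : ℕ =>
        (coloredPartitionCount 2
          (5 ^ (2 * j) * n + (11 * 5 ^ (2 * j) + 1) / 12) : ℚ)) := by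
  obtain ⟨j, rfl⟩ : ∃ t, j = t + 1 := ⟨j - 1, by omega⟩
  have h := ColoredPartition.isExpansion_odd_and_even j
  have h₅ : eulerE 5 = ColoredPartition.expand5 (PowerSeries.pentagonalSeries ℚ) :=
    ColoredPartition.eulerE_eq_expand (by norm_num)
  rw [show 2 * (j + 1) - 1 = 2 * j + 1 by omega, show 2 * (j + 1) = 2 * j + 2 by ring]
  refine ⟨?_, ?_⟩
  · convert h.1.hasSum using 2 with l
    have hl := l.pos
    rw [ColoredPartition.inv_eulerE_one_pow, h₅, ColoredPartition.basisTerm,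
      show 6 * ((l : ℕ) - 1) + 4 + 0 = 6 * l - 2 by omega,
      show 6 * ((l : ℕ) - 1) + 6 + 0 = 6 * l by omega]
    ring
  · convert h.2.hasSum using 2 with l
    have hl := l.pos
    rw [ColoredPartition.inv_eulerE_one_pow, h₅, ColoredPartition.basisTerm,
      show 6 * ((l : ℕ) - 1) + 4 + 2 = 6 * l by omega]
    ring
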